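/- Throughout, $M$ is a von Neumann algebra on a Hilbert space $H$, $M\bar\otimes M$ is the von Neumann algebra tensor product on $H\otimes H$, and "normal" means $\sigma$-weakly continuous. For normal $*$-homomorphisms (or normal $*$-anti-homomorphisms) $f,g$, the symbol $f\otimes g$ denotes the unique normal linear map with $(f\otimes g)(x\otimes y)=f(x)\otimes g(y)$; for normal functionals $\chi_1,\chi_2$ on $M$, $\chi_1\otimes\chi_2$ is the unique normal functional on $M\bar\otimes M$ with $(\chi_1\otimes\chi_2)(x\otimes y)=\chi_1(x)\chi_2(y)$. A quantum group $W^*$-algebra $G=(M,\mathfrak A,\delta,R,\{\tau_t\}_{t\in\mathbb R})$ consists of a von Neumann algebra $M$; a $\sigma$-weakly dense $C^*$-subalgebra $\mathfrak A\subset M$; a unital normal $*$-homomorphism $\delta\colon M\to M\bar\otimes M$ with $(\mathrm{id}\otimes\delta)\circ\delta=(\delta\otimes\mathrm{id})\circ\delta$; an involutive normal $*$-anti-homomorphism $R\colon M\to M$; and a one-parameter group $\{\tau_t\}_{t\in\mathbb R}$ of $*$-automorphisms of $M$ preserving $\mathfrak A$ (no continuity in $t$ is required), such that for all $t\in\mathbb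 R$ $$\delta\circ\tau_t=(\tau_t\otimes\tau_t)\circ\delta,\qquad \tau_t\circ R=R\circ\tau_t,\qquad \delta\circ R=(R\otimes R)\circ\sigma\circ\delta,$$ where $\sigma$ is the flip $x\otimes y\mapsto y\otimes x$ on $M\bar\otimes M$. A quantized character of $G$ is a normal state $\chi$ on $M$ that is $\tau$-KMS at inverse temperature $-1$: for all $x,y\in M$ there is a bounded continuous function $F$ on $\{z\in\mathbb C: -1\le\operatorname{Im}z\le 0\}$, analytic in the interior, such that $F(t)=\chi(x\tau_t(y))$ and $F(t-\mathrm i)=\chi(\tau_t(y)x)$ for all $t\in\mathbb R$. Lemma. If $\chi_1,\chi_2$ are quantized characters of a quantum group $W^*$-algebra $G$, then $(\chi_1\otimes\chi_2)\circ\delta$ is a quantized character of $G$. -/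

import Mathlib

open scoped TensorProduct

noncomputable section

universe u v w u' v'

/-! ### Hilbert space tensor products -/

/-- The Hilbert space tensor product: the completion of the algebraic tensor product for
`⟪h ⊗ k, h' ⊗ k'⟫ = ⟪h, h'⟫ ⟪k, k'⟫`. -/
abbrev HilbertTensor (H : Type u) (K : Type v) [NormedAddCommGroup H] [InnerProductSpace ℂ H]
    [NormedAddCommGroup K] [InnerProductSpace ℂ K] : Type (max u v) :=
  UniformSpace.Completion (H ⊗[ℂ] K)

section HilbertTensor

variable {H : Type u} {K : Type v} [NormedAddCommGroup H] [InnerProductSpace ℂ H]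
  [NormedAddCommGroup K] [InnerProductSpace ℂ K]

/-- The elementary tensor `h ⊗ k` in the Hilbert space tensor product. -/
def hilbertTmul (h : H) (k : K) : HilbertTensor H K :=
  ((h ⊗ₜ[ℂ] k : H ⊗[ℂ] K) : UniformSpace.Completion (H ⊗[ℂ] K))

theorem inner_map_left [CompleteSpace H] (x : H →L[ℂ] H) (s t : H ⊗[ℂ] K) :
    inner ℂ (TensorProduct.map (x : H →ₗ[ℂ] H) (LinearMap.id : K →ₗ[ℂ] K) s) t =
      inner ℂ s (TensorProduct.map ((star x : H →L[ℂ] H) : H →ₗ[ℂ] H)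
        (LinearMap.id : K →ₗ[ℂ] K) t) := by
  induction s using TensorProduct.induction_on with
  | zero => simp
  | add a b ha hb => simp only [map_add, inner_add_left, ha, hb]
  | tmul a b =>
    induction t using TensorProduct.induction_on with
    | zero => simp
    | add c d hc hd => simp only [map_add, inner_add_right, hc, hd]
    | tmul c d =>
      simp [ContinuousLinearMap.star_eq_adjoint, ContinuousLinearMap.adjoint_inner_right]

theorem norm_map_left_le [CompleteSpace H] (x : H →L[ℂ] H) (t : H ⊗[ℂ] K) :
    ‖TensorProduct.map (x : H →ₗ[ℂ] H) (LinearMap.id : K →ₗ[ℂ] K) t‖ ≤ ‖x‖ * ‖t‖ := by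
  have hpos : star x * x ≤ algebraMap ℝ (H →L[ℂ] H) (‖x‖ ^ 2) := by
    have h := IsSelfAdjoint.le_algebraMap_norm_self (IsSelfAdjoint.star_mul_self x)
    rwa [CStarRing.norm_star_mul_self, ← sq] at h
  obtain ⟨y, hy⟩ := (CStarAlgebra.nonneg_iff_eq_star_mul_self).1 (sub_nonneg.2 hpos)
  have key : ∀ z : H →L[ℂ] H,
      inner ℂ t (TensorProduct.map ((star z * z : H →L[ℂ] H) : H →ₗ[ℂ] H)
        (LinearMap.id : K →ₗ[ℂ] K) t) =
      ((‖TensorProduct.map (z : H →ₗ[ℂ] H) (LinearMap.id : K →ₗ[ℂ] K) t‖ ^ 2 : ℝ) : ℂ) := by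
    intro z
    have h := inner_self_eq_norm_sq_to_K (𝕜 := ℂ)
      (TensorProduct.map (z : H →ₗ[ℂ] H) (LinearMap.id : K →ₗ[ℂ] K) t)
    rw [inner_map_left, ← LinearMap.comp_apply, ← TensorProduct.map_comp] at h
    push_cast
    exact h
  have h1 := key y
  have h2 := key x
  have h3 : ∀ s : H ⊗[ℂ] K, TensorProduct.map ((star y * y : H →L[ℂ] H) : H →ₗ[ℂ] H)
        (LinearMap.id : K →ₗ[ℂ] K) s = ((‖x‖ ^ 2 : ℝ) : ℂ) • s -
      TensorProduct.map ((star x * x : H →L[ℂ] H) : H →ₗ[ℂ] H)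
        (LinearMap.id : K →ₗ[ℂ] K) s := by
    intro s
    rw [← hy]
    induction s using TensorProduct.induction_on with
    | zero => simp
    | add a b ha hb => simp only [map_add, ha, hb, smul_add]; abel
    | tmul a b =>
      simp only [TensorProduct.map_tmul, LinearMap.id_apply, TensorProduct.smul_tmul',
        ← TensorProduct.sub_tmul]
      congr 1
  have h5 : inner ℂ t (((‖x‖ ^ 2 : ℝ) : ℂ) • t) = ((‖x‖ ^ 2 : ℝ) : ℂ) * inner ℂ t t :=
    inner_smul_right t t _
  have h6 : inner ℂ t t = ((‖t‖ : ℂ)) ^ 2 := inner_self_eq_norm_sq_to_K t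
  rw [h3, inner_sub_right, h5, h2, h6] at h1
  have h4 : ‖x‖ ^ 2 * ‖t‖ ^ 2 -
      ‖TensorProduct.map (x : H →ₗ[ℂ] H) (LinearMap.id : K →ₗ[ℂ] K) t‖ ^ 2 =
      ‖TensorProduct.map (y : H →ₗ[ℂ] H) (LinearMap.id : K →ₗ[ℂ] K) t‖ ^ 2 := by
    exact_mod_cast h1
  refine abs_le_of_sq_le_sq' ?_ (by positivity) |>.2
  rw [mul_pow]
  nlinarith [sq_nonneg ‖TensorProduct.map (y : H →ₗ[ℂ] H) (LinearMap.id : K →ₗ[ℂ] K) t‖]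

theorem norm_map_le [CompleteSpace H] [CompleteSpace K] (x : H →L[ℂ] H) (y : K →L[ℂ] K)
    (t : H ⊗[ℂ] K) :
    ‖TensorProduct.map (x : H →ₗ[ℂ] H) (y : K →ₗ[ℂ] K) t‖ ≤ ‖x‖ * ‖y‖ * ‖t‖ := by
  have h1 : TensorProduct.map (x : H →ₗ[ℂ] H) (y : K →ₗ[ℂ] K) t =
      TensorProduct.map (x : H →ₗ[ℂ] H) (LinearMap.id : K →ₗ[ℂ] K)
        (TensorProduct.map (LinearMap.id : H →ₗ[ℂ] H) (y : K →ₗ[ℂ] K) t) := by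
    rw [← LinearMap.comp_apply, ← TensorProduct.map_comp]
    rfl
  have h2 : ‖TensorProduct.map (LinearMap.id : H →ₗ[ℂ] H) (y : K →ₗ[ℂ] K) t‖ ≤ ‖y‖ * ‖t‖ := by
    have h := norm_map_left_le y (TensorProduct.comm ℂ H K t)
    rwa [TensorProduct.map_comm, TensorProduct.norm_comm, TensorProduct.norm_comm] at h
  rw [h1, mul_assoc]
  exact (norm_map_left_le x _).trans (mul_le_mul_of_nonneg_left h2 (norm_nonneg _))

/-- The operator `x ⊗ y` on the Hilbert space tensor product: the bounded extension of
`h ⊗ k ↦ x h ⊗ y k`. -/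
def opTensor [CompleteSpace H] [CompleteSpace K] (x : H →L[ℂ] H) (y : K →L[ℂ] K) :
    HilbertTensor H K →L[ℂ] HilbertTensor H K :=
  ContinuousLinearMap.completion
    ((TensorProduct.map (x : H →ₗ[ℂ] H) (y : K →ₗ[ℂ] K)).mkContinuous (‖x‖ * ‖y‖)
      (norm_map_le x y))

theorem opTensor_tmul [CompleteSpace H] [CompleteSpace K] (x : H →L[ℂ] H) (y : K →L[ℂ] K)
    (h : H) (k : K) : opTensor x y (hilbertTmul h k) = hilbertTmul (x h) (y k) := by
  simp [opTensor, hilbertTmul]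

variable (H K) in
/-- The flip unitary `h ⊗ k ↦ k ⊗ h`. -/
def hilbertFlip : HilbertTensor H K →L[ℂ] HilbertTensor K H :=
  ContinuousLinearMap.completion
    ((TensorProduct.commIsometry ℂ H K).toContinuousLinearEquiv : H ⊗[ℂ] K →L[ℂ] K ⊗[ℂ] H)

theorem hilbertFlip_tmul (h : H) (k : K) :
    hilbertFlip H K (hilbertTmul h k) = hilbertTmul k h := by
  simp [hilbertFlip, hilbertTmul]

theorem hilbertTensor_ext {E : Type w} [NormedAddCommGroup E] [NormedSpace ℂ E]
    {S T : HilbertTensor H K →L[ℂ] E}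
    (hST : ∀ h k, S (hilbertTmul h k) = T (hilbertTmul h k)) : S = T := by
  ext z
  induction z using UniformSpace.Completion.induction_on with
  | hp => exact isClosed_eq S.continuous T.continuous
  | ih a =>
    induction a using TensorProduct.induction_on with
    | zero => simp only [UniformSpace.Completion.coe_zero, map_zero]
    | add a b ha hb => simp only [UniformSpace.Completion.coe_add, map_add, ha, hb]
    | tmul a b => exact hST a b

theorem hilbertFlip_flip : (hilbertFlip K H).comp (hilbertFlip H K) = 1 :=
  hilbertTensor_ext fun h k => by
    change hilbertFlip K H (hilbertFlip H K (hilbertTmul h k)) = hilbertTmul h k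
    rw [hilbertFlip_tmul, hilbertFlip_tmul]

theorem hilbertFlip_comp_opTensor [CompleteSpace H] [CompleteSpace K]
    (x : H →L[ℂ] H) (y : K →L[ℂ] K) :
    (hilbertFlip H K).comp (opTensor x y) = (opTensor y x).comp (hilbertFlip H K) :=
  hilbertTensor_ext fun h k => by
    change hilbertFlip H K (opTensor x y (hilbertTmul h k)) =
      opTensor y x (hilbertFlip H K (hilbertTmul h k))
    rw [hilbertFlip_tmul, opTensor_tmul, opTensor_tmul, hilbertFlip_tmul]

theorem star_opTensor [CompleteSpace H] [CompleteSpace K] (x : H →L[ℂ] H) (y : K →L[ℂ] K) :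
    star (opTensor x y) = opTensor (star x) (star y) := by
  refine hilbertTensor_ext fun h k => ?_
  refine ext_inner_left ℂ fun z => ?_
  rw [ContinuousLinearMap.star_eq_adjoint, ContinuousLinearMap.adjoint_inner_right, opTensor_tmul]
  induction z using UniformSpace.Completion.induction_on with
  | hp => exact isClosed_eq (by fun_prop) (by fun_prop)
  | ih a =>
    induction a using TensorProduct.induction_on with
    | zero => simp only [UniformSpace.Completion.coe_zero, map_zero, inner_zero_left]
    | add a b ha hb =>
      simp only [UniformSpace.Completion.coe_add, map_add, inner_add_left, ha, hb]
    | tmul a b =>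
      change inner ℂ (opTensor x y (hilbertTmul a b)) _ = inner ℂ (hilbertTmul a b) _
      rw [opTensor_tmul]
      simp [hilbertTmul, ContinuousLinearMap.star_eq_adjoint,
        ContinuousLinearMap.adjoint_inner_right]

end HilbertTensor

/-! ### Von Neumann algebras, normality, tensor products -/

namespace VonNeumannAlgebra

section Normal

variable {H : Type u} [NormedAddCommGroup H] [InnerProductSpace ℂ H] [CompleteSpace H]
  {K : Type v} [NormedAddCommGroup K] [InnerProductSpace ℂ K] [CompleteSpace K]

/-- The `*`-algebra of elements of a von Neumann algebra. -/
abbrev Elt (M : VonNeumannAlgebra H) : Type u := M.toStarSubalgebra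

/-- The von Neumann algebra generated by a set of operators: the double commutant of the set
together with the adjoints of its elements. -/
def generatedBy (S : Set (H →L[ℂ] H)) : VonNeumannAlgebra H where
  toStarSubalgebra := StarSubalgebra.centralizer ℂ (StarSubalgebra.centralizer ℂ S : Set (H →L[ℂ] H))
  centralizer_centralizer' := by
    simp

theorem subset_generatedBy (S : Set (H →L[ℂ] H)) {x : H →L[ℂ] H} (hx : x ∈ S) :
    x ∈ (generatedBy S).toStarSubalgebra :=
  StarAlgebra.adjoin_le_centralizer_centralizer ℂ S (StarAlgebra.subset_adjoin ℂ S hx)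

/-- A linear functional on `M` is normal (σ-weakly continuous, i.e. in the predual) when it has the
form `x ↦ ∑ ⟪ηₙ, x ξₙ⟫` with `∑ ‖ξₙ‖² < ∞` and `∑ ‖ηₙ‖² < ∞`. -/
def IsNormalFunctional (M : VonNeumannAlgebra H) (φ : M.Elt →ₗ[ℂ] ℂ) : Prop :=
  ∃ ξ η : ℕ → H, Summable (fun n => ‖ξ n‖ ^ 2) ∧ Summable (fun n => ‖η n‖ ^ 2) ∧
    ∀ x : M.Elt, HasSum (fun n => inner ℂ (η n) ((x : H →L[ℂ] H) (ξ n))) (φ x)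

/-- The σ-weak topology on `M`: the coarsest one that makes all normal functionals continuous. -/
abbrev sigmaWeakTopology (M : VonNeumannAlgebra H) : TopologicalSpace M.Elt :=
  ⨅ (φ : M.Elt →ₗ[ℂ] ℂ) (_ : IsNormalFunctional M φ), TopologicalSpace.induced φ inferInstance

/-- A linear map between von Neumann algebras is normal when it is continuous for the σ-weak
topologies, i.e. when it pulls normal functionals back to normal functionals. -/
def IsNormalMap {M : VonNeumannAlgebra H} {N : VonNeumannAlgebra K} (f : M.Elt →ₗ[ℂ] N.Elt) :
    Prop :=
  ∀ φ : N.Elt →ₗ[ℂ] ℂ, IsNormalFunctional N φ → IsNormalFunctional M (φ ∘ₗ f)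

/-- A state on `M`: a positive linear functional with value `1` at the unit. -/
def IsState (M : VonNeumannAlgebra H) (φ : M.Elt →ₗ[ℂ] ℂ) : Prop :=
  (∀ x : M.Elt, 0 ≤ (φ (star x * x)).re ∧ (φ (star x * x)).im = 0) ∧ φ 1 = 1

/-- The KMS condition at inverse temperature `β` for a functional `φ` and a family `τ` of
automorphisms of `M`: for all `x, y` there is a bounded continuous function `F` on the closed strip
between `Im z = 0` and `Im z = β`, analytic in its interior, with `F t = φ (x τ_t(y))` and
`F (t + i β) = φ (τ_t(y) x)` for all real `t`. -/
def IsKMS {M : VonNeumannAlgebra H} (τ : ℝ → M.Elt ≃⋆ₐ[ℂ] M.Elt) (β : ℝ)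
    (φ : M.Elt →ₗ[ℂ] ℂ) : Prop :=
  ∀ x y : M.Elt, ∃ F : ℂ → ℂ,
    ContinuousOn F {z | z.im ∈ Set.uIcc 0 β} ∧
    (∃ C : ℝ, ∀ z : ℂ, z.im ∈ Set.uIcc 0 β → ‖F z‖ ≤ C) ∧
    DifferentiableOn ℂ F {z | z.im ∈ Set.uIoo 0 β} ∧
    ∀ t : ℝ, F t = φ (x * τ t y) ∧ F (t + β * Complex.I) = φ (τ t y * x)

end Normal

section Tensor

variable {H₁ : Type u} [NormedAddCommGroup H₁] [InnerProductSpace ℂ H₁] [CompleteSpace H₁]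
  {H₂ : Type v} [NormedAddCommGroup H₂] [InnerProductSpace ℂ H₂] [CompleteSpace H₂]

/-- The von Neumann algebra tensor product `M ⊗̄ N`: generated by all `x ⊗ y`, `x ∈ M`, `y ∈ N`. -/
def tensor (M : VonNeumannAlgebra H₁) (N : VonNeumannAlgebra H₂) :
    VonNeumannAlgebra (HilbertTensor H₁ H₂) :=
  generatedBy {T | ∃ x ∈ M, ∃ y ∈ N, T = opTensor x y}

/-- The elementary tensor `x ⊗ y` in `M ⊗̄ N`. -/
def tmul {M : VonNeumannAlgebra H₁} {N : VonNeumannAlgebra H₂} (x : M.Elt) (y : N.Elt) :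
    (M.tensor N).Elt :=
  ⟨opTensor (x : H₁ →L[ℂ] H₁) (y : H₂ →L[ℂ] H₂),
    subset_generatedBy _ ⟨x, x.2, y, y.2, rfl⟩⟩

/-- `ψ` is the tensor product of the functionals `φ₁` and `φ₂`: the (unique) normal functional on
`M ⊗̄ N` with `ψ (x ⊗ y) = φ₁ x φ₂ y`. -/
def IsTensorFunctional {M : VonNeumannAlgebra H₁} {N : VonNeumannAlgebra H₂}
    (φ₁ : M.Elt →ₗ[ℂ] ℂ) (φ₂ : N.Elt →ₗ[ℂ] ℂ) (ψ : (M.tensor N).Elt →ₗ[ℂ] ℂ) : Prop :=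
  IsNormalFunctional (M.tensor N) ψ ∧ ∀ x y, ψ (tmul x y) = φ₁ x * φ₂ y

open Classical in
/-- The tensor product `φ₁ ⊗ φ₂` of two normal functionals. (For functionals that have no normal
tensor product, the value is `0`.) -/
def tensorFunctional {M : VonNeumannAlgebra H₁} {N : VonNeumannAlgebra H₂}
    (φ₁ : M.Elt →ₗ[ℂ] ℂ) (φ₂ : N.Elt →ₗ[ℂ] ℂ) : (M.tensor N).Elt →ₗ[ℂ] ℂ :=
  if h : ∃ ψ, IsTensorFunctional φ₁ φ₂ ψ then h.choose else 0

theorem flip_conj_mem {M : VonNeumannAlgebra H₁} {N : VonNeumannAlgebra H₂}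
    (z : (M.tensor N).Elt) :
    (hilbertFlip H₁ H₂).comp ((z : HilbertTensor H₁ H₂ →L[ℂ] HilbertTensor H₁ H₂).comp
      (hilbertFlip H₂ H₁)) ∈ (N.tensor M).toStarSubalgebra := by
  obtain ⟨z, hz⟩ := z
  have hcomm : ∀ c ∈ StarSubalgebra.centralizer ℂ
      {T : HilbertTensor H₂ H₁ →L[ℂ] HilbertTensor H₂ H₁ |
        ∃ x ∈ N, ∃ y ∈ M, T = opTensor x y},
      (hilbertFlip H₂ H₁).comp (c.comp (hilbertFlip H₁ H₂)) ∈ StarSubalgebra.centralizer ℂ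
        {T : HilbertTensor H₁ H₂ →L[ℂ] HilbertTensor H₁ H₂ |
          ∃ x ∈ M, ∃ y ∈ N, T = opTensor x y} := by
    intro c hc
    have comm : ∀ x ∈ M, ∀ y ∈ N, opTensor x y *
        (hilbertFlip H₂ H₁).comp (c.comp (hilbertFlip H₁ H₂)) =
        (hilbertFlip H₂ H₁).comp (c.comp (hilbertFlip H₁ H₂)) * opTensor x y := by
      intro x hx y hy
      have h := ((StarSubalgebra.mem_centralizer_iff ℂ).1 hc _ ⟨y, hy, x, hx, rfl⟩).1
      calc _ = ((opTensor x y).comp (hilbertFlip H₂ H₁)).comp (c.comp (hilbertFlip H₁ H₂)) := rfl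
        _ = (hilbertFlip H₂ H₁).comp ((opTensor y x * c).comp (hilbertFlip H₁ H₂)) := by
          rw [← hilbertFlip_comp_opTensor]; rfl
        _ = (hilbertFlip H₂ H₁).comp (c.comp ((opTensor y x).comp (hilbertFlip H₁ H₂))) := by
          rw [h]; rfl
        _ = _ := by rw [← hilbertFlip_comp_opTensor]; rfl
    refine (StarSubalgebra.mem_centralizer_iff ℂ).2 ?_
    rintro _ ⟨x, hx, y, hy, rfl⟩
    refine ⟨comm x hx y hy, ?_⟩
    rw [star_opTensor]
    exact comm _ (star_mem hx) _ (star_mem hy)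
  have hz' : ∀ c ∈ StarSubalgebra.centralizer ℂ
      {T : HilbertTensor H₂ H₁ →L[ℂ] HilbertTensor H₂ H₁ |
        ∃ x ∈ N, ∃ y ∈ M, T = opTensor x y},
      c * (hilbertFlip H₁ H₂).comp (z.comp (hilbertFlip H₂ H₁)) =
      (hilbertFlip H₁ H₂).comp (z.comp (hilbertFlip H₂ H₁)) * c := by
    intro c hc
    have h := ((StarSubalgebra.mem_centralizer_iff ℂ).1 hz _ (hcomm c hc)).1
    calc _ = ((hilbertFlip H₁ H₂).comp (hilbertFlip H₂ H₁)).comp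
          ((c.comp (hilbertFlip H₁ H₂)).comp (z.comp (hilbertFlip H₂ H₁))) := by
            rw [hilbertFlip_flip]; rfl
      _ = (hilbertFlip H₁ H₂).comp (((hilbertFlip H₂ H₁).comp (c.comp (hilbertFlip H₁ H₂)) *
          z).comp (hilbertFlip H₂ H₁)) := rfl
      _ = (hilbertFlip H₁ H₂).comp (z.comp ((hilbertFlip H₂ H₁).comp (c.comp
          ((hilbertFlip H₁ H₂).comp (hilbertFlip H₂ H₁))))) := by rw [h]; rfl
      _ = _ := by rw [hilbertFlip_flip]; rfl
  refine (StarSubalgebra.mem_centralizer_iff ℂ).2 fun c hc => ⟨hz' c hc, hz' _ (star_mem hc)⟩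

/-- The flip `σ : M ⊗̄ N → N ⊗̄ M`, `x ⊗ y ↦ y ⊗ x`: conjugation by the flip unitary. -/
def flip (M : VonNeumannAlgebra H₁) (N : VonNeumannAlgebra H₂) :
    (M.tensor N).Elt →ₗ[ℂ] (N.tensor M).Elt where
  toFun z := ⟨(hilbertFlip H₁ H₂).comp
    ((z : HilbertTensor H₁ H₂ →L[ℂ] HilbertTensor H₁ H₂).comp (hilbertFlip H₂ H₁)),
    flip_conj_mem z⟩
  map_add' x y := by ext; simp
  map_smul' c x := by ext; simp

variable {K₁ : Type u'} [NormedAddCommGroup K₁] [InnerProductSpace ℂ K₁] [CompleteSpace K₁]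
  {K₂ : Type v'} [NormedAddCommGroup K₂] [InnerProductSpace ℂ K₂] [CompleteSpace K₂]

/-- `Φ` is the tensor product of the linear maps `f` and `g`: the (unique) normal linear map
`M ⊗̄ N → M' ⊗̄ N'` with `Φ (x ⊗ y) = f x ⊗ g y`. -/
def IsTensorMap {M : VonNeumannAlgebra H₁} {N : VonNeumannAlgebra H₂}
    {M' : VonNeumannAlgebra K₁} {N' : VonNeumannAlgebra K₂}
    (f : M.Elt →ₗ[ℂ] M'.Elt) (g : N.Elt →ₗ[ℂ] N'.Elt)
    (Φ : (M.tensor N).Elt →ₗ[ℂ] (M'.tensor N').Elt) : Prop :=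
  IsNormalMap Φ ∧ ∀ x y, Φ (tmul x y) = tmul (f x) (g y)

open Classical in
/-- The tensor product `f ⊗ g` of two normal `*`-homomorphisms, or of two normal
`*`-anti-homomorphisms. (For linear maps that have no normal tensor product, the value is `0`.) -/
def tensorMap {M : VonNeumannAlgebra H₁} {N : VonNeumannAlgebra H₂}
    {M' : VonNeumannAlgebra K₁} {N' : VonNeumannAlgebra K₂}
    (f : M.Elt →ₗ[ℂ] M'.Elt) (g : N.Elt →ₗ[ℂ] N'.Elt) :
    (M.tensor N).Elt →ₗ[ℂ] (M'.tensor N').Elt :=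
  if h : ∃ Φ, IsTensorMap f g Φ then h.choose else 0

end Tensor

end VonNeumannAlgebra

/-! ### Quantum group W*-algebras and quantized characters -/

/-- Operators `S` on `H ⊗ (H ⊗ H)` and `T` on `(H ⊗ H) ⊗ H` correspond to each other under the
canonical unitary `(a ⊗ b) ⊗ c ↦ a ⊗ (b ⊗ c)`: they have the same matrix coefficients on elementary
tensors, which span dense subspaces. -/
def IsReassociation {H : Type u} [NormedAddCommGroup H] [InnerProductSpace ℂ H]
    (S : HilbertTensor H (HilbertTensor H H) →L[ℂ] HilbertTensor H (HilbertTensor H H))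
    (T : HilbertTensor (HilbertTensor H H) H →L[ℂ] HilbertTensor (HilbertTensor H H) H) : Prop :=
  ∀ a b c a' b' c' : H,
    inner ℂ (hilbertTmul a (hilbertTmul b c)) (S (hilbertTmul a' (hilbertTmul b' c'))) =
      inner ℂ (hilbertTmul (hilbertTmul a b) c) (T (hilbertTmul (hilbertTmul a' b') c'))

open VonNeumannAlgebra in
/-- A quantum group W*-algebra `(M, 𝔄, δ, R, τ)` with underlying von Neumann algebra `M`.
The one-parameter group `τ` is not required to be continuous. -/
structure QuantumGroupWStarAlgebra {H : Type u} [NormedAddCommGroup H] [InnerProductSpace ℂ H]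
    [CompleteSpace H] (M : VonNeumannAlgebra H) where
  /-- the σ-weakly dense C*-subalgebra -/
  𝔄 : NonUnitalStarSubalgebra ℂ M.Elt
  isClosed_𝔄 : IsClosed (𝔄 : Set M.Elt)
  dense_𝔄 : @Dense M.Elt (sigmaWeakTopology M) (𝔄 : Set M.Elt)
  /-- the comultiplication, a unital normal `*`-homomorphism -/
  δ : M.Elt →⋆ₐ[ℂ] (M.tensor M).Elt
  normal_δ : IsNormalMap δ.toAlgHom.toLinearMap
  /-- `(id ⊗ δ) ∘ δ = (δ ⊗ id) ∘ δ` -/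
  coassoc : ∀ x : M.Elt,
    IsReassociation (tensorMap (LinearMap.id : M.Elt →ₗ[ℂ] M.Elt) δ.toAlgHom.toLinearMap (δ x)).1
      (tensorMap δ.toAlgHom.toLinearMap (LinearMap.id : M.Elt →ₗ[ℂ] M.Elt) (δ x)).1
  /-- the unitary antipode, an involutive normal `*`-anti-homomorphism -/
  R : M.Elt →ₗ[ℂ] M.Elt
  normal_R : IsNormalMap R
  R_mul : ∀ x y, R (x * y) = R y * R x
  R_star : ∀ x, R (star x) = star (R x)
  R_R : ∀ x, R (R x) = x
  /-- the deformation automorphism group -/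
  τ : ℝ → M.Elt ≃⋆ₐ[ℂ] M.Elt
  τ_zero : ∀ x, τ 0 x = x
  τ_add : ∀ s t x, τ (s + t) x = τ s (τ t x)
  τ_𝔄 : ∀ t, ∀ x ∈ 𝔄, τ t x ∈ 𝔄
  /-- `δ ∘ τ_t = (τ_t ⊗ τ_t) ∘ δ` -/
  δ_τ : ∀ t x, δ (τ t x) =
    tensorMap (τ t).toAlgEquiv.toLinearMap (τ t).toAlgEquiv.toLinearMap (δ x)
  /-- `τ_t ∘ R = R ∘ τ_t` -/
  τ_R : ∀ t x, τ t (R x) = R (τ t x)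
  /-- `δ ∘ R = (R ⊗ R) ∘ σ ∘ δ` -/
  δ_R : ∀ x, δ (R x) = tensorMap R R (flip M M (δ x))

namespace QuantumGroupWStarAlgebra

open VonNeumannAlgebra

variable {H : Type u} [NormedAddCommGroup H] [InnerProductSpace ℂ H] [CompleteSpace H]
  {M : VonNeumannAlgebra H}

/-- The set `Char(G)` of quantized characters of `G`: the normal `τ`-KMS states on `M` at inverse
temperature `-1`. -/
def Char (G : QuantumGroupWStarAlgebra M) : Set (M.Elt →ₗ[ℂ] ℂ) :=
  {χ | IsNormalFunctional M χ ∧ IsState M χ ∧ IsKMS G.τ (-1) χ}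

/-- The functional `(χ₁ ⊗ χ₂) ∘ δ`. -/
def tensorChar (G : QuantumGroupWStarAlgebra M) (χ₁ χ₂ : M.Elt →ₗ[ℂ] ℂ) : M.Elt →ₗ[ℂ] ℂ :=
  tensorFunctional χ₁ χ₂ ∘ₗ G.δ.toAlgHom.toLinearMap

end QuantumGroupWStarAlgebra

end

/-!
For normal states `χ₁`, `χ₂` given by square summable sequences of vectors, the tensor products of
these vectors define `ψ = χ₁ ⊗ χ₂`, so `ψ ∘ δ` is normal. It is a state because `ψ` is one: on
algebraic tensors positivity is the Schur product theorem, and it extends to `M ⊗̄ M` by density.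

For the KMS condition, `δ` intertwines `τ_t` with `Φ_t = τ_t ⊗ τ_t`, so it suffices that `ψ` is KMS
for `Φ_t` (`IsTensorFunctional.hasStripExtension`). For elementary tensors the required function on
the strip is the product of the functions for `χ₁` and `χ₂`. The passage from algebraic tensors to
`M ⊗̄ M` rests on three facts.

* Algebraic tensors are dense for the seminorms `z ↦ ψ(z* z)` and `z ↦ ψ(z z*)` simultaneously
  (`exists_mem_span_ampliation_lt`). This is the double commutant theorem for the action on
  `ℓ²(ℕ, H)` together with a Hahn-Banach argument.
* A KMS state is invariant under its automorphism group: the function for the pair `1, y` has equal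
  boundary values, so its periodic continuation is entire by Morera's theorem and constant by
  Liouville's (`HasStripExtension.apply_eq_apply_of_same_boundary`). Hence `ψ ∘ Φ_t = ψ`, and by the
  Cauchy-Schwarz inequality the boundary values of the functions on the strip depend continuously on
  the two elements, uniformly in `t`.
* By the Phragmén-Lindelöf principle, uniform convergence on the boundary of the strip implies
  uniform convergence on the strip (`HasStripExtension.of_approx`).
-/

noncomputable section

/-! ### Boundary values of bounded analytic functions on a strip -/

/-- `f` and `g` are the boundary values, on `Im z = 0` and `Im z = β`, of a bounded continuous
function on the closed strip between these lines that is analytic in the interior. -/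
def HasStripExtension (β : ℝ) (f g : ℝ → ℂ) : Prop :=
  ∃ F : ℂ → ℂ,
    ContinuousOn F {z | z.im ∈ Set.uIcc 0 β} ∧
    (∃ C : ℝ, ∀ z : ℂ, z.im ∈ Set.uIcc 0 β → ‖F z‖ ≤ C) ∧
    DifferentiableOn ℂ F {z | z.im ∈ Set.uIoo 0 β} ∧
    ∀ t : ℝ, F t = f t ∧ F (t + β * Complex.I) = g t

namespace HasStripExtension

open Set Complex Filter Topology

variable {β : ℝ} {f g f' g' : ℝ → ℂ}

theorem zero : HasStripExtension β 0 0 :=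
  ⟨0, continuousOn_const, ⟨0, fun _ _ => by simp⟩, differentiableOn_const _, fun _ => by simp⟩

theorem add (h : HasStripExtension β f g) (h' : HasStripExtension β f' g') :
    HasStripExtension β (f + f') (g + g') := by
  obtain ⟨F, hc, ⟨C, hC⟩, hd, hF⟩ := h
  obtain ⟨F', hc', ⟨C', hC'⟩, hd', hF'⟩ := h'
  exact ⟨F + F', hc.add hc', ⟨C + C', fun z hz => (norm_add_le _ _).trans
    (add_le_add (hC z hz) (hC' z hz))⟩, hd.add hd', fun t => by simp [hF, hF']⟩

theorem mul (h : HasStripExtension β f g) (h' : HasStripExtension β f' g') :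
    HasStripExtension β (f * f') (g * g') := by
  obtain ⟨F, hc, ⟨C, hC⟩, hd, hF⟩ := h
  obtain ⟨F', hc', ⟨C', hC'⟩, hd', hF'⟩ := h'
  refine ⟨F * F', hc.mul hc', ⟨C * C', fun z hz => ?_⟩, hd.mul hd', fun t => by simp [hF, hF']⟩
  rw [Pi.mul_apply, norm_mul]
  exact mul_le_mul (hC z hz) (hC' z hz) (norm_nonneg _) ((norm_nonneg _).trans (hC z hz))

theorem const_smul (c : ℂ) (h : HasStripExtension β f g) :
    HasStripExtension β (c • f) (c • g) := by
  obtain ⟨F, hc, ⟨C, hC⟩, hd, hF⟩ := h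
  refine ⟨c • F, hc.const_smul c, ⟨‖c‖ * C, fun z hz => ?_⟩, hd.const_smul c,
    fun t => by simp [hF]⟩
  rw [Pi.smul_apply, norm_smul]
  exact mul_le_mul_of_nonneg_left (hC z hz) (norm_nonneg _)

/-- A bounded analytic function on a strip is bounded by its supremum on the boundary. -/
theorem norm_le_of_boundary {F : ℂ → ℂ} (hβ : β ≠ 0)
    (hc : ContinuousOn F {z | z.im ∈ uIcc 0 β})
    (hb : ∃ C : ℝ, ∀ z : ℂ, z.im ∈ uIcc 0 β → ‖F z‖ ≤ C)
    (hd : DifferentiableOn ℂ F {z | z.im ∈ uIoo 0 β}) {ε : ℝ}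
    (h0 : ∀ t : ℝ, ‖F t‖ ≤ ε) (h1 : ∀ t : ℝ, ‖F (t + β * I)‖ ≤ ε) {z : ℂ}
    (hz : z.im ∈ uIcc 0 β) : ‖F z‖ ≤ ε := by
  have hbd : ∀ w : ℂ, w.im = 0 ∨ w.im = β → ‖F w‖ ≤ ε := by
    rintro w (hw | hw)
    · have : w = (w.re : ℂ) := Complex.ext (by simp) (by simp [hw])
      rw [this]; exact h0 _
    · have : w = (w.re : ℂ) + β * I := Complex.ext (by simp) (by simp [hw])
      rw [this]; exact h1 _
  have hlt : min 0 β < max 0 β := by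
    rcases lt_or_gt_of_ne hβ with h | h
    · simp [h, h.le]
    · simp [h, h.le]
  refine PhragmenLindelof.horizontal_strip (a := min 0 β) (b := max 0 β) ⟨hd, ?_⟩ ?_ ?_ ?_ hz.1 hz.2
  · refine hc.mono (closure_minimal (fun w hw => ⟨hw.1.le, hw.2.le⟩) ?_)
    exact isClosed_Icc.preimage Complex.continuous_im
  · obtain ⟨C, hC⟩ := hb
    refine ⟨0, div_pos Real.pi_pos (sub_pos.2 hlt), 0, Asymptotics.IsBigO.of_bound C ?_⟩
    refine Filter.eventually_inf_principal.2 (Filter.Eventually.of_forall fun w hw => ?_)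
    simpa using hC w ⟨hw.1.le, hw.2.le⟩
  · intro w hw
    exact hbd w (by rcases min_choice 0 β with h | h <;> simp [hw, h])
  · intro w hw
    exact hbd w (by rcases max_choice 0 β with h | h <;> simp [hw, h])

/-- Having a strip extension is stable under uniform approximation of the boundary values. -/
theorem of_approx (hβ : β ≠ 0)
    (h : ∀ ε > 0, ∃ f' g' : ℝ → ℂ, HasStripExtension β f' g' ∧
      (∀ t, ‖f' t - f t‖ ≤ ε) ∧ ∀ t, ‖g' t - g t‖ ≤ ε) :
    HasStripExtension β f g := by
  have hpos : ∀ n : ℕ, (0 : ℝ) < (1 / 2) ^ n := fun n => by positivity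
  choose f' g' hfg hf hg using fun n : ℕ => h _ (hpos n)
  choose F hc hb hd hF using hfg
  have hdist : ∀ m n, ∀ z ∈ {z : ℂ | z.im ∈ uIcc 0 β},
      ‖F m z - F n z‖ ≤ (1 / 2) ^ m + (1 / 2) ^ n := by
    intro m n z hz
    refine norm_le_of_boundary (F := fun z => F m z - F n z) hβ ((hc m).sub (hc n)) ?_
      ((hd m).sub (hd n)) (fun t => ?_) (fun t => ?_) hz
    · obtain ⟨C, hC⟩ := hb m
      obtain ⟨C', hC'⟩ := hb n
      exact ⟨C + C', fun z hz => (norm_sub_le _ _).trans (add_le_add (hC z hz) (hC' z hz))⟩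
    · rw [(hF m t).1, (hF n t).1, ← sub_sub_sub_cancel_right _ _ (f t)]
      exact (norm_sub_le _ _).trans (add_le_add (hf m t) (hf n t))
    · rw [(hF m t).2, (hF n t).2, ← sub_sub_sub_cancel_right _ _ (g t)]
      exact (norm_sub_le _ _).trans (add_le_add (hg m t) (hg n t))
  have hlim0 : Tendsto (fun n : ℕ => ((1 : ℝ) / 2) ^ n) atTop (𝓝 0) :=
    tendsto_pow_atTop_nhds_zero_of_lt_one (by norm_num) (by norm_num)
  have huc : UniformCauchySeqOn F atTop {z | z.im ∈ uIcc 0 β} := by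
    rw [Metric.uniformCauchySeqOn_iff]
    intro ε hε
    obtain ⟨N, hN⟩ := (hlim0.eventually (gt_mem_nhds (half_pos hε))).exists_forall_of_atTop
    refine ⟨N, fun m hm n hn z hz => ?_⟩
    rw [dist_eq_norm]
    linarith [hdist m n z hz, hN m hm, hN n hn]
  -- off the closed strip the `F n` need not converge, and the limit is chosen arbitrarily
  have hex : ∀ z : ℂ, ∃ w : ℂ, z.im ∈ uIcc 0 β → Tendsto (fun n => F n z) atTop (𝓝 w) := by
    intro z
    by_cases hz : z.im ∈ uIcc 0 β
    · obtain ⟨w, hw⟩ := cauchySeq_tendsto_of_complete (huc.cauchySeq hz)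
      exact ⟨w, fun _ => hw⟩
    · exact ⟨0, fun h => absurd h hz⟩
  choose G hG using hex
  have hunif : TendstoUniformlyOn F G atTop {z | z.im ∈ uIcc 0 β} :=
    huc.tendstoUniformlyOn_of_tendsto fun z hz => hG z hz
  have hsub : {z : ℂ | z.im ∈ uIoo 0 β} ⊆ {z | z.im ∈ uIcc 0 β} :=
    fun z hz => ⟨hz.1.le, hz.2.le⟩
  have hopen : IsOpen {z : ℂ | z.im ∈ uIoo 0 β} :=
    isOpen_Ioo.preimage Complex.continuous_im
  have hmem : ∀ t : ℝ, (t : ℂ).im ∈ uIcc 0 β ∧ ((t : ℂ) + β * I).im ∈ uIcc 0 β := by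
    intro t
    simp
  refine ⟨G, hunif.continuousOn (Eventually.of_forall hc).frequently, ?_,
    (hunif.mono hsub).tendstoLocallyUniformlyOn.differentiableOn (Eventually.of_forall hd) hopen,
    fun t => ⟨?_, ?_⟩⟩
  · obtain ⟨C, hC⟩ := hb 0
    refine ⟨C + 2, fun z hz => le_of_tendsto (hG z hz).norm (Eventually.of_forall fun n => ?_)⟩
    have h1 := hdist n 0 z hz
    have h2 : ((1 : ℝ) / 2) ^ n ≤ 1 := pow_le_one₀ (by norm_num) (by norm_num)
    have h3 := norm_sub_norm_le (F n z) (F 0 z)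
    have h4 := hC z hz
    norm_num at h1
    norm_num at h2
    linarith
  · refine tendsto_nhds_unique (hG t (hmem t).1) (tendsto_iff_norm_sub_tendsto_zero.2 ?_)
    refine squeeze_zero (fun _ => norm_nonneg _) (fun n => ?_) hlim0
    rw [(hF n t).1]; exact hf n t
  · refine tendsto_nhds_unique (hG _ (hmem t).2) (tendsto_iff_norm_sub_tendsto_zero.2 ?_)
    refine squeeze_zero (fun _ => norm_nonneg _) (fun n => ?_) hlim0
    rw [(hF n t).2]; exact hg n t

/-- A continuous function on `ℂ` that is analytic off equidistant horizontal lines is entire: its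
integrals over rectangles vanish, as they do over the pieces cut out by the lines. -/
theorem differentiable_of_off_lines {F : ℂ → ℂ} (hc : Continuous F)
    (hd : ∀ n : ℤ, DifferentiableOn ℂ F {z | z.im ∈ uIoo (n * β) ((n + 1) * β)}) (hβ : β ≠ 0) :
    Differentiable ℂ F := by
  suffices h : IsConservativeOn F univ from differentiableOn_univ.1
    (IsExactOn.differentiableOn isOpen_univ (h.isExactOn_univ hc))
  intro z w _
  rw [← add_eq_zero_iff_eq_neg, wedgeIntegral_add_wedgeIntegral_eq]
  -- `B s t` is the integral over the boundary of the rectangle between the heights `s` and `t`.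
  set B : ℝ → ℝ → ℂ := fun s t => (∫ x : ℝ in z.re..w.re, F (x + s * I)) -
      (∫ x : ℝ in z.re..w.re, F (x + t * I)) +
      I • (∫ y : ℝ in s..t, F (w.re + y * I)) -
      I • (∫ y : ℝ in s..t, F (z.re + y * I)) with hB
  have hadd : ∀ r s t, B r s + B s t = B r t := by
    intro r s t
    have h1 : ∀ a : ℝ, (∫ y : ℝ in r..s, F (a + y * I)) + (∫ y : ℝ in s..t, F (a + y * I)) =
        ∫ y : ℝ in r..t, F (a + y * I) := fun a =>
      intervalIntegral.integral_add_adjacent_intervals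
        ((by fun_prop : Continuous fun y : ℝ => F (a + y * I)).intervalIntegrable _ _)
        ((by fun_prop : Continuous fun y : ℝ => F (a + y * I)).intervalIntegrable _ _)
    simp only [hB, ← h1, smul_eq_mul]
    ring
  have hpiece : ∀ (n : ℤ) (s t : ℝ), s ∈ uIcc (n * β) ((n + 1) * β) →
      t ∈ uIcc (n * β) ((n + 1) * β) → B s t = 0 := by
    intro n s t hs ht
    have h := integral_boundary_rect_eq_zero_of_continuousOn_of_differentiableOn F
      (z.re + s * I) (w.re + t * I) hc.continuousOn ((hd n).mono ?_)
    · simpa [hB] using h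
    · rintro x ⟨_, hx⟩
      simp only [add_im, ofReal_im, mul_im, ofReal_re, I_im, mul_one, I_re, mul_zero, add_zero,
        zero_add, mem_preimage] at hx
      exact ⟨(le_min hs.1 ht.1).trans_lt hx.1, hx.2.trans_le (max_le hs.2 ht.2)⟩
  -- cut the rectangle between `0` and `n β` along the lines
  have hint : ∀ n : ℤ, B 0 (n * β) = 0 := by
    intro n
    induction n using Int.induction_on with
    | zero => exact hpiece 0 _ _ (by simp) (by simp)
    | succ k ih =>
      rw [← hadd 0 ((k : ℤ) * β), ih, hpiece k _ _ left_mem_uIcc (by push_cast; simp), zero_add]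
    | pred k ih =>
      rw [← hadd 0 ((-k : ℤ) * β), ih, hpiece (-k - 1) _ _ (by push_cast; simp)
        (by push_cast; simp), zero_add]
  have hreal : ∀ t : ℝ, B 0 t = 0 := by
    intro t
    rw [← hadd 0 (⌊t / β⌋ * β), hint, hpiece ⌊t / β⌋ _ _ left_mem_uIcc ?_, zero_add]
    have h1 := Int.floor_le (t / β)
    have h2 := (Int.lt_floor_add_one (t / β)).le
    have h3 : t = t / β * β := by field_simp
    rw [mem_uIcc]
    rcases lt_or_gt_of_ne hβ with h | h
    · right
      constructor <;> nlinarith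
    · left
      constructor <;> nlinarith
  have h := hadd 0 z.im w.im
  rwa [hreal, hreal, zero_add] at h

/-- If the two boundary values of a bounded analytic function on a strip agree, then they are
constant: the periodic continuation of the function is entire and bounded. -/
theorem apply_eq_apply_of_same_boundary (hβ : β ≠ 0) (h : HasStripExtension β f f) (s t : ℝ) :
    f s = f t := by
  obtain ⟨F, hc, ⟨C, hC⟩, hd, hF⟩ := h
  have hIcc : ∀ r ∈ Icc (0 : ℝ) 1, r * β ∈ uIcc 0 β := by
    intro r hr
    rw [mem_uIcc]
    rcases le_total 0 β with h | h
    · left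
      constructor <;> nlinarith [hr.1, hr.2]
    · right
      constructor <;> nlinarith [hr.1, hr.2]
  -- the `β i`-periodic continuation of `F`
  let G : ℂ → ℂ := fun z => F (z.re + (Int.fract (z.im / β) * β : ℝ) * I)
  have hGc : Continuous G := by
    refine ContinuousOn.comp_fract (f := fun (z : ℂ) (r : ℝ) => F (z.re + (r * β : ℝ) * I))
      (s := fun z : ℂ => z.im / β) ?_ (by fun_prop) ?_
    · refine hc.comp (by fun_prop) ?_
      rintro ⟨z, r⟩ ⟨_, hr⟩
      simpa using hIcc r hr
    · intro z
      have := hF z.re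
      simp only [zero_mul, ofReal_zero, add_zero, one_mul]
      rw [this.1, this.2]
  have hGd : ∀ n : ℤ, DifferentiableOn ℂ G {z | z.im ∈ uIoo (n * β) ((n + 1) * β)} := by
    intro n
    have hfl : ∀ z : ℂ, z.im ∈ uIoo (n * β) ((n + 1) * β) →
        n < z.im / β ∧ z.im / β < n + 1 := by
      intro z hz
      rcases lt_or_gt_of_ne hβ with h | h
      · rw [uIoo_of_ge (by nlinarith)] at hz
        exact ⟨(lt_div_iff_of_neg h).2 hz.2, (div_lt_iff_of_neg h).2 hz.1⟩
      · rw [uIoo_of_le (by nlinarith)] at hz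
        exact ⟨(lt_div_iff₀ h).2 hz.1, (div_lt_iff₀ h).2 hz.2⟩
    have heq : ∀ z ∈ {z : ℂ | z.im ∈ uIoo (n * β) ((n + 1) * β)},
        G z = F (z - (n * β : ℝ) * I) := by
      intro z hz
      have h1 : ⌊z.im / β⌋ = n := Int.floor_eq_iff.2 ⟨(hfl z hz).1.le, (hfl z hz).2⟩
      simp only [G, Int.fract, h1]
      congr 1
      refine Complex.ext (by simp) ?_
      simp
      field_simp
    refine DifferentiableOn.congr ?_ heq
    refine hd.comp (by fun_prop) ?_
    intro z hz
    have h3 : z.im = z.im / β * β := by field_simp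
    have := hfl z hz
    simp only [mem_ofPred_eq, sub_im, mul_im, ofReal_re, I_im, mul_one, ofReal_im, I_re, mul_zero,
      add_zero]
    rcases lt_or_gt_of_ne hβ with h | h
    · rw [uIoo_of_ge h.le]
      constructor <;> nlinarith
    · rw [uIoo_of_le h.le]
      constructor <;> nlinarith
  have hGb : Bornology.IsBounded (range G) := by
    refine (Metric.isBounded_closedBall (x := (0 : ℂ)) (r := C)).subset ?_
    rintro _ ⟨z, rfl⟩
    rw [mem_closedBall_zero_iff]
    refine hC _ ?_
    simpa using hIcc _ ⟨Int.fract_nonneg (z.im / β), (Int.fract_lt_one (z.im / β)).le⟩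
  have key := (differentiable_of_off_lines hGc hGd hβ).apply_eq_apply_of_bounded hGb s t
  simpa [G, (hF s).1, (hF t).1] using key

end HasStripExtension

/-! ### The infinite ampliation and the double commutant theorem -/

namespace VonNeumannAlgebra

open scoped InnerProductSpace

section Ampliation

variable {H : Type u} [NormedAddCommGroup H] [InnerProductSpace ℂ H]

/-- The Hilbert space `ℓ²(ℕ, H)` of square summable sequences of vectors. -/
abbrev SqSummable (H : Type u) [NormedAddCommGroup H] [InnerProductSpace ℂ H] : Type u :=
  lp (fun _ : ℕ => H) 2

/-- A square summable sequence as a vector of `ℓ²(ℕ, H)`. -/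
def SqSummable.mk (ξ : ℕ → H) (hξ : Summable fun n => ‖ξ n‖ ^ 2) : SqSummable H :=
  ⟨ξ, memℓp_gen (by simpa using hξ)⟩

theorem SqSummable.summable (ξ : SqSummable H) : Summable fun n => ‖ξ n‖ ^ 2 := by
  simpa using (lp.memℓp ξ).summable (by simp)

/-- The ampliation of an operator on `H`: it acts on `ℓ²(ℕ, H)` entrywise. -/
def ampliation (a : H →L[ℂ] H) : SqSummable H →L[ℂ] SqSummable H :=
  lp.mapCLM 2 (fun _ => a) (norm_nonneg a) fun _ => le_rfl

@[simp]
theorem ampliation_apply (a : H →L[ℂ] H) (ξ : SqSummable H) (n : ℕ) :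
    ampliation a ξ n = a (ξ n) := rfl

@[simp]
theorem ampliation_one (ξ : SqSummable H) : ampliation (1 : H →L[ℂ] H) ξ = ξ := by
  ext; simp

theorem ampliation_mul (a b : H →L[ℂ] H) (ξ : SqSummable H) :
    ampliation (a * b) ξ = ampliation a (ampliation b ξ) := by
  ext; simp

theorem ampliation_add (a b : H →L[ℂ] H) (ξ : SqSummable H) :
    ampliation (a + b) ξ = ampliation a ξ + ampliation b ξ := by
  ext; simp

theorem ampliation_sub (a b : H →L[ℂ] H) (ξ : SqSummable H) :
    ampliation (a - b) ξ = ampliation a ξ - ampliation b ξ := by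
  ext; simp

theorem ampliation_smul (c : ℂ) (a : H →L[ℂ] H) (ξ : SqSummable H) :
    ampliation (c • a) ξ = c • ampliation a ξ := by
  ext; simp

theorem ampliation_single (a : H →L[ℂ] H) (n : ℕ) (h : H) :
    ampliation a (lp.single 2 n h) = lp.single 2 n (a h) := by
  ext m
  rw [ampliation_apply, lp.single_apply, lp.single_apply]
  rcases eq_or_ne m n with rfl | hmn
  · simp
  · simp [hmn]

variable [CompleteSpace H]

theorem inner_ampliation_star_left (a : H →L[ℂ] H) (η ξ : SqSummable H) :
    ⟪ampliation (star a) η, ξ⟫_ℂ = ⟪η, ampliation a ξ⟫_ℂ := by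
  simp only [lp.inner_eq_tsum, ampliation_apply, ContinuousLinearMap.star_eq_adjoint,
    ContinuousLinearMap.adjoint_inner_left]

theorem inner_ampliation_left (a : H →L[ℂ] H) (η ξ : SqSummable H) :
    ⟪ampliation a η, ξ⟫_ℂ = ⟪η, ampliation (star a) ξ⟫_ℂ := by
  rw [← inner_ampliation_star_left, star_star]

/-- An operator on `ℓ²(ℕ, H)` that commutes with the ampliations of a set of operators and of their
adjoints commutes with the ampliation of the von Neumann algebra they generate, since its matrix
entries lie in the commutant. -/
theorem apply_ampliation_of_commute {S : Set (H →L[ℂ] H)}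
    {T : SqSummable H →L[ℂ] SqSummable H}
    (hT : ∀ s ∈ S, ∀ ξ, T (ampliation s ξ) = ampliation s (T ξ))
    (hT' : ∀ s ∈ S, ∀ ξ, T (ampliation (star s) ξ) = ampliation (star s) (T ξ))
    {z : H →L[ℂ] H} (hz : z ∈ (generatedBy S).toStarSubalgebra) (ξ : SqSummable H) :
    T (ampliation z ξ) = ampliation z (T ξ) := by
  suffices h : T.comp (ampliation z) = (ampliation z).comp T from DFunLike.congr_fun h ξ
  refine lp.ext_continuousLinearMap (by simp) fun n => ?_
  ext h m
  -- the matrix entry `(m, n)` of `T`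
  let t : H →L[ℂ] H :=
    (lp.evalCLM ℂ (fun _ : ℕ => H) 2 m).comp
      (T.comp (lp.singleContinuousLinearMap ℂ (fun _ : ℕ => H) 2 n))
  have ht : ∀ k : H, t k = T (lp.single 2 n k) m := fun k => rfl
  have htS : t ∈ StarSubalgebra.centralizer ℂ S := by
    refine (StarSubalgebra.mem_centralizer_iff ℂ).2 fun s hs => ⟨?_, ?_⟩
    · ext k
      simp only [mul_apply_eq_comp, ht, ← ampliation_single, hT s hs, ampliation_apply]
    · ext k
      simp only [mul_apply_eq_comp, ht, ← ampliation_single, hT' s hs,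
        ampliation_apply]
  have hcomm := DFunLike.congr_fun ((StarSubalgebra.mem_centralizer_iff ℂ).1 hz t htS).1 h
  simp only [mul_apply_eq_comp, ht] at hcomm
  simpa [ampliation_single] using hcomm

/-- The double commutant theorem in its σ-weak form: a functional `x ↦ ⟪η, x ξ⟫` on `ℓ²(ℕ, H)` that
vanishes on a self-adjoint multiplicative set containing `1` vanishes on the von Neumann algebra it
generates. -/
theorem inner_ampliation_eq_zero_of_generatedBy {S : Set (H →L[ℂ] H)} (h1 : 1 ∈ S)
    (hmul : ∀ s ∈ S, ∀ t ∈ S, s * t ∈ S) (hstar : ∀ s ∈ S, star s ∈ S) {η ξ : SqSummable H}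
    (h : ∀ s ∈ S, ⟪η, ampliation s ξ⟫_ℂ = 0) {z : H →L[ℂ] H}
    (hz : z ∈ (generatedBy S).toStarSubalgebra) : ⟪η, ampliation z ξ⟫_ℂ = 0 := by
  let V₀ : Submodule ℂ (SqSummable H) := Submodule.span ℂ ((fun s => ampliation s ξ) '' S)
  let V : Submodule ℂ (SqSummable H) := V₀.topologicalClosure
  have : CompleteSpace V := V₀.isClosed_topologicalClosure.completeSpace_coe
  have hVS : ∀ s ∈ S, ∀ v ∈ V, ampliation s v ∈ V := by
    intro s hs
    refine (Module.End.mem_invtSubmodule_iff_forall_mem_of_mem _).1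
      (Submodule.topologicalClosure_mem_invtSubmodule (f := ampliation s) ?_)
    rw [Module.End.mem_invtSubmodule_iff_map_le]
    refine (Submodule.map_span_le _ _ _).2 ?_
    rintro _ ⟨t, ht, rfl⟩
    exact Submodule.subset_span ⟨s * t, hmul s hs t ht, ampliation_mul s t ξ⟩
  have hP : ∀ s ∈ S, ∀ v, V.starProjection (ampliation s v) = ampliation s (V.starProjection v) := by
    intro s hs v
    refine Submodule.eq_starProjection_of_mem_of_inner_eq_zero
      (hVS s hs _ (Submodule.starProjection_apply_mem _ _)) fun w hw => ?_
    rw [← map_sub, inner_ampliation_left]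
    exact Submodule.starProjection_inner_eq_zero v _ (hVS _ (hstar s hs) w hw)
  have hξ : ξ ∈ V := V₀.le_topologicalClosure
    (Submodule.subset_span ⟨1, h1, ampliation_one ξ⟩)
  have hzV : ampliation z ξ ∈ V := by
    rw [← Submodule.starProjection_eq_self_iff,
      apply_ampliation_of_commute hP (fun s hs => hP _ (hstar s hs)) hz,
      Submodule.starProjection_eq_self_iff.2 hξ]
  have hη : V ≤ LinearMap.ker (innerSL ℂ η : SqSummable H →ₗ[ℂ] ℂ) := by
    refine Submodule.topologicalClosure_minimal _ (Submodule.span_le.2 ?_)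
      (innerSL ℂ η).isClosed_ker
    rintro _ ⟨s, hs, rfl⟩
    exact h s hs
  exact hη hzV

end Ampliation

/-! ### Normal functionals -/

section Normal

variable {H : Type u} [NormedAddCommGroup H] [InnerProductSpace ℂ H] [CompleteSpace H]

/-- The normal functional `x ↦ ∑ ⟪ηₙ, x ξₙ⟫`. -/
def vectorFunctional (M : VonNeumannAlgebra H) (η ξ : SqSummable H) : M.Elt →ₗ[ℂ] ℂ where
  toFun x := ⟪η, ampliation (x : H →L[ℂ] H) ξ⟫_ℂ
  map_add' x y := by
    rw [← inner_add_right, ← ampliation_add]; rfl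
  map_smul' c x := by
    rw [RingHom.id_apply, smul_eq_mul, ← inner_smul_right, ← ampliation_smul]; rfl

theorem vectorFunctional_apply (M : VonNeumannAlgebra H) (η ξ : SqSummable H) (x : M.Elt) :
    vectorFunctional M η ξ x = ⟪η, ampliation (x : H →L[ℂ] H) ξ⟫_ℂ := rfl

theorem isNormalFunctional_iff {M : VonNeumannAlgebra H} {φ : M.Elt →ₗ[ℂ] ℂ} :
    IsNormalFunctional M φ ↔ ∃ η ξ, φ = vectorFunctional M η ξ := by
  constructor
  · rintro ⟨ξ, η, hξ, hη, h⟩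
    refine ⟨.mk η hη, .mk ξ hξ, LinearMap.ext fun x => ?_⟩
    exact (h x).unique (lp.hasSum_inner (SqSummable.mk η hη) (ampliation x.1 (.mk ξ hξ)))
  · rintro ⟨η, ξ, rfl⟩
    exact ⟨ξ, η, ξ.summable, η.summable, fun x => lp.hasSum_inner η (ampliation x.1 ξ)⟩

theorem isNormalFunctional_vectorFunctional (M : VonNeumannAlgebra H) (η ξ : SqSummable H) :
    IsNormalFunctional M (vectorFunctional M η ξ) :=
  isNormalFunctional_iff.2 ⟨η, ξ, rfl⟩

namespace IsNormalFunctional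

variable {M : VonNeumannAlgebra H} {φ ψ : M.Elt →ₗ[ℂ] ℂ}

/-- The sequences defining a normal functional may be indexed by any denumerable type. -/
theorem of_denumerable {ι : Type*} (e : ι ≃ ℕ) {ξ η : ι → H}
    (hξ : Summable fun i => ‖ξ i‖ ^ 2) (hη : Summable fun i => ‖η i‖ ^ 2)
    (h : ∀ x : M.Elt, HasSum (fun i => ⟪η i, (x : H →L[ℂ] H) (ξ i)⟫_ℂ) (φ x)) :
    IsNormalFunctional M φ :=
  ⟨fun n => ξ (e.symm n), fun n => η (e.symm n),
    (Equiv.summable_iff e.symm (f := fun i => ‖ξ i‖ ^ 2)).2 hξ,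
    (Equiv.summable_iff e.symm (f := fun i => ‖η i‖ ^ 2)).2 hη, fun x =>
    (Equiv.hasSum_iff e.symm (f := fun i => ⟪η i, (x : H →L[ℂ] H) (ξ i)⟫_ℂ)).2 (h x)⟩

theorem add (hφ : IsNormalFunctional M φ) (hψ : IsNormalFunctional M ψ) :
    IsNormalFunctional M (φ + ψ) := by
  obtain ⟨ξ, η, hξ, hη, h⟩ := hφ
  obtain ⟨ξ', η', hξ', hη', h'⟩ := hψ
  refine of_denumerable Equiv.natSumNatEquivNat (ξ := Sum.elim ξ ξ') (η := Sum.elim η η')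
    ?_ ?_ fun x => ?_
  · exact (HasSum.sum (f := fun i => ‖Sum.elim ξ ξ' i‖ ^ 2) hξ.hasSum hξ'.hasSum).summable
  · exact (HasSum.sum (f := fun i => ‖Sum.elim η η' i‖ ^ 2) hη.hasSum hη'.hasSum).summable
  · exact HasSum.sum (f := fun i => ⟪Sum.elim η η' i, x.1 (Sum.elim ξ ξ' i)⟫_ℂ) (h x) (h' x)

theorem smul (c : ℂ) (hφ : IsNormalFunctional M φ) : IsNormalFunctional M (c • φ) := by
  obtain ⟨η, ξ, rfl⟩ := isNormalFunctional_iff.1 hφ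
  refine isNormalFunctional_iff.2 ⟨η, c • ξ, LinearMap.ext fun x => ?_⟩
  simp [vectorFunctional_apply]

theorem sub (hφ : IsNormalFunctional M φ) (hψ : IsNormalFunctional M ψ) :
    IsNormalFunctional M (φ - ψ) := by
  have := hφ.add (hψ.smul (-1))
  rwa [neg_one_smul, ← sub_eq_add_neg] at this

theorem mulRight (hφ : IsNormalFunctional M φ) (y : M.Elt) :
    IsNormalFunctional M (φ ∘ₗ LinearMap.mulRight ℂ y) := by
  obtain ⟨η, ξ, rfl⟩ := isNormalFunctional_iff.1 hφ
  refine isNormalFunctional_iff.2 ⟨η, ampliation y.1 ξ, LinearMap.ext fun x => ?_⟩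
  simp [vectorFunctional_apply, ampliation_mul]

theorem mulLeft (hφ : IsNormalFunctional M φ) (y : M.Elt) :
    IsNormalFunctional M (φ ∘ₗ LinearMap.mulLeft ℂ y) := by
  obtain ⟨η, ξ, rfl⟩ := isNormalFunctional_iff.1 hφ
  refine isNormalFunctional_iff.2 ⟨ampliation (star y.1) η, ξ, LinearMap.ext fun x => ?_⟩
  simp [vectorFunctional_apply, ampliation_mul, inner_ampliation_left]

end IsNormalFunctional

/-- The functional `x ↦ conj (φ (x*))`. -/
def starFunctional {M : VonNeumannAlgebra H} (φ : M.Elt →ₗ[ℂ] ℂ) : M.Elt →ₗ[ℂ] ℂ where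
  toFun x := star (φ (star x))
  map_add' x y := by simp
  map_smul' c x := by simp

theorem IsNormalFunctional.starFunctional {M : VonNeumannAlgebra H} {φ : M.Elt →ₗ[ℂ] ℂ}
    (hφ : IsNormalFunctional M φ) : IsNormalFunctional M (starFunctional φ) := by
  obtain ⟨η, ξ, rfl⟩ := isNormalFunctional_iff.1 hφ
  refine isNormalFunctional_iff.2 ⟨ξ, η, LinearMap.ext fun x => ?_⟩
  change star ⟪η, ampliation (star x.1) ξ⟫_ℂ = ⟪ξ, ampliation x.1 η⟫_ℂ
  rw [← inner_ampliation_left]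
  exact inner_conj_symm _ _

/-- Normal functionals separate the points of a von Neumann algebra. -/
theorem ext_normalFunctional {M : VonNeumannAlgebra H} {x y : M.Elt}
    (h : ∀ φ : M.Elt →ₗ[ℂ] ℂ, IsNormalFunctional M φ → φ x = φ y) : x = y := by
  ext k
  refine ext_inner_left ℂ fun l => ?_
  have := h _ (isNormalFunctional_vectorFunctional M (lp.single 2 0 l) (lp.single 2 0 k))
  simpa [vectorFunctional_apply, lp.inner_single_left] using this

/-- A normal functional is determined by its values on a self-adjoint multiplicative generating set
that contains `1`. -/
theorem IsNormalFunctional.eq_zero_of_generatedBy {S : Set (H →L[ℂ] H)} (h1 : 1 ∈ S)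
    (hmul : ∀ s ∈ S, ∀ t ∈ S, s * t ∈ S) (hstar : ∀ s ∈ S, star s ∈ S)
    {φ : (generatedBy S).Elt →ₗ[ℂ] ℂ} (hφ : IsNormalFunctional (generatedBy S) φ)
    (h : ∀ x : (generatedBy S).Elt, (x : H →L[ℂ] H) ∈ S → φ x = 0) : φ = 0 := by
  obtain ⟨η, ξ, rfl⟩ := isNormalFunctional_iff.1 hφ
  exact LinearMap.ext fun z => inner_ampliation_eq_zero_of_generatedBy h1 hmul hstar
    (fun s hs => h ⟨s, subset_generatedBy S hs⟩ hs) z.2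

/-- Density of the linear span of a self-adjoint multiplicative generating set `S ∋ 1` for the
σ-strong* topology, tested on two vectors of `ℓ²(ℕ, H)`. By the Hahn-Banach theorem, a point outside
the closure would be separated by the real part of a normal functional vanishing on `S`. -/
theorem exists_mem_span_ampliation_lt {S : Set (H →L[ℂ] H)} (h1 : 1 ∈ S)
    (hmul : ∀ s ∈ S, ∀ t ∈ S, s * t ∈ S) (hstar : ∀ s ∈ S, star s ∈ S)
    (z : (generatedBy S).Elt) (ξ η : SqSummable H) {ε : ℝ} (hε : 0 < ε) :
    ∃ a ∈ Submodule.span ℂ {x : (generatedBy S).Elt | (x : H →L[ℂ] H) ∈ S},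
      ‖ampliation (z - a : (generatedBy S).Elt).1 ξ‖ < ε ∧
      ‖ampliation (z - a : (generatedBy S).Elt).1 η‖ < ε ∧
      ‖ampliation (star (z - a) : (generatedBy S).Elt).1 ξ‖ < ε ∧
      ‖ampliation (star (z - a) : (generatedBy S).Elt).1 η‖ < ε := by
  set A := Submodule.span ℂ {x : (generatedBy S).Elt | (x : H →L[ℂ] H) ∈ S}
  let L : (generatedBy S).Elt → (SqSummable H × SqSummable H) × SqSummable H × SqSummable H :=
    fun x => ((ampliation x.1 ξ, ampliation x.1 η),
      (ampliation (star x).1 ξ, ampliation (star x).1 η))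
  have hLadd : ∀ x y, L (x + y) = L x + L y := by
    intro x y
    simp [L, ampliation_add]
  have hLsub : ∀ x y, L (x - y) = L x - L y := by
    intro x y
    simp [L, ampliation_sub]
  have hLsmul : ∀ (r : ℝ) x, L ((r : ℂ) • x) = r • L x := by
    intro r x
    have h : ∀ (y : H →L[ℂ] H) ζ, ampliation (r • y) ζ = r • ampliation y ζ :=
      fun y ζ => by ext; simp
    simp [L, h]
  suffices hcl : L z ∈ closure (L '' A) by
    obtain ⟨_, ⟨a, ha, rfl⟩, hlt⟩ := Metric.mem_closure_iff.1 hcl ε hε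
    rw [dist_eq_norm, ← hLsub] at hlt
    have h1 := (norm_fst_le (L (z - a))).trans_lt hlt
    have h2 := (norm_snd_le (L (z - a))).trans_lt hlt
    exact ⟨a, ha, (norm_fst_le _).trans_lt h1, (norm_snd_le _).trans_lt h1,
      (norm_fst_le _).trans_lt h2, (norm_snd_le _).trans_lt h2⟩
  by_contra hz
  have hconv : Convex ℝ (L '' A) := by
    rintro _ ⟨x, hx, rfl⟩ _ ⟨y, hy, rfl⟩ s t - - -
    exact ⟨(s : ℂ) • x + (t : ℂ) • y, A.add_mem (A.smul_mem _ hx) (A.smul_mem _ hy),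
      by rw [hLadd, hLsmul, hLsmul]⟩
  obtain ⟨f, r, hf, hr⟩ :=
    geometric_hahn_banach_closed_point hconv.closure isClosed_closure hz
  -- a linear functional bounded above on a subspace vanishes there
  have hfA : ∀ a ∈ A, f (L a) = 0 := by
    intro a ha
    by_contra hne
    have h := hf _ (subset_closure ⟨((r / f (L a) : ℝ) : ℂ) • a, A.smul_mem _ ha, rfl⟩)
    rw [hLsmul, map_smul, smul_eq_mul, div_mul_cancel₀ _ hne] at h
    exact lt_irrefl _ h
  have hr0 : 0 < r := by
    have h := hf _ (subset_closure ⟨0, A.zero_mem, rfl⟩)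
    rwa [hfA 0 A.zero_mem] at h
  -- each component of `f` is the real part of a complex functional, given by a vector
  have hrep : ∀ g : StrongDual ℝ (SqSummable H), ∃ ζ : SqSummable H, ∀ v, g v = (⟪ζ, v⟫_ℂ).re := by
    intro g
    refine ⟨(InnerProductSpace.toDual ℂ (SqSummable H)).symm (g.extendRCLike (𝕜 := ℂ)),
      fun v => ?_⟩
    rw [InnerProductSpace.toDual_symm_apply]
    exact (StrongDual.re_extendRCLike_apply (𝕜 := ℂ) g v).symm
  obtain ⟨ζ₁, h₁⟩ := hrep ((f.comp (.inl ℝ _ _)).comp (.inl ℝ _ _))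
  obtain ⟨ζ₂, h₂⟩ := hrep ((f.comp (.inl ℝ _ _)).comp (.inr ℝ _ _))
  obtain ⟨ζ₃, h₃⟩ := hrep ((f.comp (.inr ℝ _ _)).comp (.inl ℝ _ _))
  obtain ⟨ζ₄, h₄⟩ := hrep ((f.comp (.inr ℝ _ _)).comp (.inr ℝ _ _))
  let φ : (generatedBy S).Elt →ₗ[ℂ] ℂ := vectorFunctional _ ζ₁ ξ + vectorFunctional _ ζ₂ η +
    (vectorFunctional _ ξ ζ₃ + vectorFunctional _ η ζ₄)
  have hφn : IsNormalFunctional _ φ :=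
    ((isNormalFunctional_vectorFunctional _ _ _).add (isNormalFunctional_vectorFunctional _ _ _)).add
    ((isNormalFunctional_vectorFunctional _ _ _).add (isNormalFunctional_vectorFunctional _ _ _))
  have hfφ : ∀ x, f (L x) = (φ x).re := by
    intro x
    have hL : L x = ContinuousLinearMap.inl ℝ _ _ (ContinuousLinearMap.inl ℝ _ _ (L x).1.1) +
        ContinuousLinearMap.inl ℝ _ _ (ContinuousLinearMap.inr ℝ _ _ (L x).1.2) +
        (ContinuousLinearMap.inr ℝ _ _ (ContinuousLinearMap.inl ℝ _ _ (L x).2.1) +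
        ContinuousLinearMap.inr ℝ _ _ (ContinuousLinearMap.inr ℝ _ _ (L x).2.2)) := by
      simp
    have h₃' : (⟪ζ₃, ampliation (star x.1) ξ⟫_ℂ).re = (⟪ξ, ampliation x.1 ζ₃⟫_ℂ).re := by
      rw [← inner_ampliation_left]; exact inner_re_symm (𝕜 := ℂ) _ _
    have h₄' : (⟪ζ₄, ampliation (star x.1) η⟫_ℂ).re = (⟪η, ampliation x.1 ζ₄⟫_ℂ).re := by
      rw [← inner_ampliation_left]; exact inner_re_symm (𝕜 := ℂ) _ _
    rw [hL, map_add, map_add, map_add]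
    simp only [φ, LinearMap.add_apply, Complex.add_re, vectorFunctional_apply, ← h₃', ← h₄']
    exact congrArg₂ _ (congrArg₂ _ (h₁ _) (h₂ _)) (congrArg₂ _ (h₃ _) (h₄ _))
  have hφ0 : φ = 0 := by
    refine hφn.eq_zero_of_generatedBy h1 hmul hstar fun x hx => ?_
    have hxA : x ∈ A := Submodule.subset_span hx
    have hre := hfA x hxA
    have him := hfA _ (A.smul_mem Complex.I hxA)
    rw [hfφ] at hre him
    rw [map_smul, smul_eq_mul, Complex.I_mul_re, neg_eq_zero] at him
    exact Complex.ext hre him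
  rw [hfφ, hφ0] at hr
  exact lt_asymm hr0 (by simpa using hr)

end Normal

/-! ### The Cauchy-Schwarz inequality for states -/

section State

variable {H : Type u} [NormedAddCommGroup H] [InnerProductSpace ℂ H] [CompleteSpace H]
  {M : VonNeumannAlgebra H} {φ : M.Elt →ₗ[ℂ] ℂ}

theorem IsState.map_star_mul (h : IsState M φ) (x y : M.Elt) :
    star (φ (star y * x)) = φ (star x * y) := by
  have hx := (h.1 x).2
  have hy := (h.1 y).2
  -- polarization: `φ (star z * z)` is real for `z = x + y` and for `z = x + i y`
  have h1 := (h.1 (x + y)).2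
  have h2 := (h.1 (x + Complex.I • y)).2
  simp only [star_add, star_smul, add_mul, mul_add, smul_mul_assoc, mul_smul_comm, map_add,
    map_smul, smul_eq_mul, Complex.add_im, RCLike.star_def, Complex.conj_I, Complex.mul_im,
    Complex.mul_re, Complex.I_re, Complex.I_im, Complex.neg_re, Complex.neg_im, hx, hy] at h1 h2
  refine Complex.ext ?_ ?_
  · simp only [RCLike.star_def, Complex.conj_re]; linarith
  · simp only [RCLike.star_def, Complex.conj_im]; linarith

/-- The semi-inner product `⟪x, y⟫ = φ (x* y)` of a state `φ`. -/
abbrev IsState.core (h : IsState M φ) : PreInnerProductSpace.Core ℂ M.Elt where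
  inner x y := φ (star x * y)
  conj_inner_symm x y := h.map_star_mul x y
  re_inner_nonneg x := (h.1 x).1
  add_left x y z := by simp [add_mul]
  smul_left x y r := by simp

theorem IsState.norm_map_star_mul_sq_le (h : IsState M φ) (x y : M.Elt) :
    ‖φ (star x * y)‖ ^ 2 ≤ (φ (star x * x)).re * (φ (star y * y)).re := by
  have key : ‖φ (star x * y)‖ * ‖φ (star y * x)‖ ≤ (φ (star x * x)).re * (φ (star y * y)).re :=
    @InnerProductSpace.Core.inner_mul_inner_self_le ℂ M.Elt _ _ _ h.core x y
  rwa [← h.map_star_mul x y, norm_star, ← sq, ← norm_star, h.map_star_mul x y] at key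

open Matrix ComplexOrder in
theorem IsState.posSemidef (h : IsState M φ) {n : ℕ} (x : Fin n → M.Elt) :
    (Matrix.of fun i j => φ (star (x i) * x j)).PosSemidef := by
  refine posSemidef_iff_dotProduct_mulVec.2 ⟨?_, fun c => ?_⟩
  · ext i j
    exact h.map_star_mul (x i) (x j)
  · have key : star c ⬝ᵥ ((Matrix.of fun i j => φ (star (x i) * x j)) *ᵥ c) =
        φ (star (∑ i, c i • x i) * ∑ i, c i • x i) := by
      rw [star_sum, Finset.sum_mul_sum, map_sum]
      refine Finset.sum_congr rfl fun i _ => ?_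
      simp only [map_sum, mulVec, dotProduct, Finset.mul_sum]
      refine Finset.sum_congr rfl fun j _ => ?_
      simp only [Matrix.of_apply, star_smul, smul_mul_smul_comm, map_smul, smul_eq_mul,
        Pi.star_apply]
      ring
    rw [key]
    exact Complex.nonneg_iff.2 ⟨(h.1 _).1, (h.1 _).2.symm⟩

end State

/-! ### Elementary tensors and tensor products of normal states -/

section Hilbert

variable {H₁ : Type u} [NormedAddCommGroup H₁] [InnerProductSpace ℂ H₁]
  {H₂ : Type v} [NormedAddCommGroup H₂] [InnerProductSpace ℂ H₂]

theorem norm_hilbertTmul (h : H₁) (k : H₂) : ‖hilbertTmul h k‖ = ‖h‖ * ‖k‖ := by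
  simp [hilbertTmul]

theorem inner_hilbertTmul (h h' : H₁) (k k' : H₂) :
    ⟪hilbertTmul h k, hilbertTmul h' k'⟫_ℂ = ⟪h, h'⟫_ℂ * ⟪k, k'⟫_ℂ := by
  simp [hilbertTmul]

theorem hasSum_mul_unpair {f g : ℕ → ℂ} {a b : ℂ} (hf : HasSum f a) (hg : HasSum g b) :
    HasSum (fun n : ℕ => f n.unpair.1 * g n.unpair.2) (a * b) := by
  have h := hf.mul hg (summable_mul_of_summable_norm hf.summable.norm hg.summable.norm)
  exact (Equiv.hasSum_iff Nat.pairEquiv.symm (f := fun p : ℕ × ℕ => f p.1 * g p.2)).2 h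

theorem summable_mul_unpair {f g : ℕ → ℝ} (hf : Summable f) (hg : Summable g) (hf0 : 0 ≤ f)
    (hg0 : 0 ≤ g) : Summable fun n : ℕ => f n.unpair.1 * g n.unpair.2 :=
  (Equiv.summable_iff Nat.pairEquiv.symm (f := fun p : ℕ × ℕ => f p.1 * g p.2)).2
    (hf.mul_of_nonneg hg hf0 hg0)

/-- The family `ξᵢ ⊗ ξ'ⱼ` of two square summable sequences, enumerated by the pairing of `ℕ`. -/
def SqSummable.tmul (ξ : SqSummable H₁) (ξ' : SqSummable H₂) : SqSummable (HilbertTensor H₁ H₂) :=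
  .mk (fun n => hilbertTmul (ξ n.unpair.1) (ξ' n.unpair.2)) <| by
    simpa only [norm_hilbertTmul, mul_pow] using summable_mul_unpair ξ.summable ξ'.summable
      (fun _ => sq_nonneg _) (fun _ => sq_nonneg _)

theorem SqSummable.tmul_apply (ξ : SqSummable H₁) (ξ' : SqSummable H₂) (n : ℕ) :
    SqSummable.tmul ξ ξ' n = hilbertTmul (ξ n.unpair.1) (ξ' n.unpair.2) := rfl

end Hilbert

section Tensor

variable {H₁ : Type u} [NormedAddCommGroup H₁] [InnerProductSpace ℂ H₁] [CompleteSpace H₁]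
  {H₂ : Type v} [NormedAddCommGroup H₂] [InnerProductSpace ℂ H₂] [CompleteSpace H₂]

theorem opTensor_mul_opTensor (x x' : H₁ →L[ℂ] H₁) (y y' : H₂ →L[ℂ] H₂) :
    opTensor x y * opTensor x' y' = opTensor (x * x') (y * y') :=
  hilbertTensor_ext fun h k => by
    simp [mul_apply_eq_comp, opTensor_tmul]

theorem opTensor_one : opTensor (1 : H₁ →L[ℂ] H₁) (1 : H₂ →L[ℂ] H₂) = 1 :=
  hilbertTensor_ext fun h k => by simp [opTensor_tmul]

variable {M : VonNeumannAlgebra H₁} {N : VonNeumannAlgebra H₂}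

theorem tmul_mul_tmul (x x' : M.Elt) (y y' : N.Elt) :
    tmul x y * tmul x' y' = tmul (x * x') (y * y') :=
  Subtype.ext (opTensor_mul_opTensor _ _ _ _)

theorem star_tmul (x : M.Elt) (y : N.Elt) : star (tmul x y) = tmul (star x) (star y) :=
  Subtype.ext (star_opTensor _ _)

theorem tmul_one : tmul (1 : M.Elt) (1 : N.Elt) = 1 :=
  Subtype.ext opTensor_one

variable (M N) in
/-- The algebraic tensor product of `M` and `N`, as a subspace of `M ⊗̄ N`. -/
def algTensor : Submodule ℂ (M.tensor N).Elt :=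
  Submodule.span ℂ (Set.range fun p : M.Elt × N.Elt => tmul p.1 p.2)

theorem one_mem_tensorGenerators :
    (1 : HilbertTensor H₁ H₂ →L[ℂ] HilbertTensor H₁ H₂) ∈
      {T | ∃ x ∈ M, ∃ y ∈ N, T = opTensor x y} :=
  ⟨1, one_mem M, 1, one_mem N, opTensor_one.symm⟩

theorem mul_mem_tensorGenerators :
    ∀ s ∈ {T | ∃ x ∈ M, ∃ y ∈ N, T = opTensor x y},
      ∀ t ∈ {T | ∃ x ∈ M, ∃ y ∈ N, T = opTensor x y},
        s * t ∈ {T | ∃ x ∈ M, ∃ y ∈ N, T = opTensor x y} := by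
  rintro _ ⟨x, hx, y, hy, rfl⟩ _ ⟨x', hx', y', hy', rfl⟩
  exact ⟨x * x', mul_mem hx hx', y * y', mul_mem hy hy', opTensor_mul_opTensor _ _ _ _⟩

theorem star_mem_tensorGenerators :
    ∀ s ∈ {T | ∃ x ∈ M, ∃ y ∈ N, T = opTensor x y},
      star s ∈ {T | ∃ x ∈ M, ∃ y ∈ N, T = opTensor x y} := by
  rintro _ ⟨x, hx, y, hy, rfl⟩
  exact ⟨star x, star_mem hx, star y, star_mem hy, star_opTensor _ _⟩

/-- Normal functionals on `M ⊗̄ N` that agree on elementary tensors are equal. -/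
theorem IsNormalFunctional.ext_tmul {φ ψ : (M.tensor N).Elt →ₗ[ℂ] ℂ}
    (hφ : IsNormalFunctional (M.tensor N) φ) (hψ : IsNormalFunctional (M.tensor N) ψ)
    (h : ∀ x y, φ (tmul x y) = ψ (tmul x y)) : φ = ψ := by
  refine sub_eq_zero.1 (IsNormalFunctional.eq_zero_of_generatedBy one_mem_tensorGenerators
    mul_mem_tensorGenerators star_mem_tensorGenerators (hφ.sub hψ) ?_)
  rintro ⟨_, hz⟩ ⟨x, hx, y, hy, rfl⟩
  exact sub_eq_zero.2 (h ⟨x, hx⟩ ⟨y, hy⟩)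

theorem exists_mem_algTensor_ampliation_lt (z : (M.tensor N).Elt)
    (ξ η : SqSummable (HilbertTensor H₁ H₂)) {ε : ℝ} (hε : 0 < ε) :
    ∃ a ∈ algTensor M N,
      ‖ampliation (z - a : (M.tensor N).Elt).1 ξ‖ < ε ∧
      ‖ampliation (z - a : (M.tensor N).Elt).1 η‖ < ε ∧
      ‖ampliation (star (z - a) : (M.tensor N).Elt).1 ξ‖ < ε ∧
      ‖ampliation (star (z - a) : (M.tensor N).Elt).1 η‖ < ε := by
  obtain ⟨a, ha, h⟩ := exists_mem_span_ampliation_lt one_mem_tensorGenerators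
    mul_mem_tensorGenerators star_mem_tensorGenerators z ξ η hε
  refine ⟨a, Submodule.span_mono ?_ ha, h⟩
  rintro ⟨_, hz⟩ ⟨x, hx, y, hy, rfl⟩
  exact ⟨(⟨x, hx⟩, ⟨y, hy⟩), rfl⟩

/-- Two normal functionals have a normal tensor product: if they are given by the sequences
`ηᵢ, ξᵢ` and `η'ⱼ, ξ'ⱼ`, then it is given by `ηᵢ ⊗ η'ⱼ, ξᵢ ⊗ ξ'ⱼ`. -/
theorem exists_isTensorFunctional {φ₁ : M.Elt →ₗ[ℂ] ℂ} {φ₂ : N.Elt →ₗ[ℂ] ℂ}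
    (h₁ : IsNormalFunctional M φ₁) (h₂ : IsNormalFunctional N φ₂) :
    ∃ ψ, IsTensorFunctional φ₁ φ₂ ψ := by
  obtain ⟨η, ξ, rfl⟩ := isNormalFunctional_iff.1 h₁
  obtain ⟨η', ξ', rfl⟩ := isNormalFunctional_iff.1 h₂
  refine ⟨vectorFunctional _ (SqSummable.tmul η η') (SqSummable.tmul ξ ξ'),
    isNormalFunctional_vectorFunctional _ _ _, fun x y => ?_⟩
  have hx := lp.hasSum_inner (𝕜 := ℂ) η (ampliation x.1 ξ)
  have hy := lp.hasSum_inner (𝕜 := ℂ) η' (ampliation y.1 ξ')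
  refine (lp.hasSum_inner (𝕜 := ℂ) (SqSummable.tmul η η')
    (ampliation (tmul x y).1 (SqSummable.tmul ξ ξ'))).unique
    ((hasSum_mul_unpair hx hy).congr_fun fun n => ?_)
  rw [ampliation_apply, SqSummable.tmul_apply, SqSummable.tmul_apply, tmul, opTensor_tmul,
    inner_hilbertTmul, ampliation_apply, ampliation_apply]

theorem isTensorFunctional_tensorFunctional {φ₁ : M.Elt →ₗ[ℂ] ℂ} {φ₂ : N.Elt →ₗ[ℂ] ℂ}
    (h₁ : IsNormalFunctional M φ₁) (h₂ : IsNormalFunctional N φ₂) :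
    IsTensorFunctional φ₁ φ₂ (tensorFunctional φ₁ φ₂) := by
  have h := exists_isTensorFunctional h₁ h₂
  rw [tensorFunctional, dif_pos h]
  exact h.choose_spec

open Matrix ComplexOrder in
/-- The tensor product of two states is positive on the algebraic tensor product, by the Schur
product theorem. -/
theorem IsTensorFunctional.nonneg_of_mem_algTensor {φ₁ : M.Elt →ₗ[ℂ] ℂ} {φ₂ : N.Elt →ₗ[ℂ] ℂ}
    {ψ : (M.tensor N).Elt →ₗ[ℂ] ℂ} (h : IsTensorFunctional φ₁ φ₂ ψ) (h₁ : IsState M φ₁)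
    (h₂ : IsState N φ₂) {a : (M.tensor N).Elt} (ha : a ∈ algTensor M N) :
    0 ≤ (ψ (star a * a)).re ∧ (ψ (star a * a)).im = 0 := by
  obtain ⟨n, c, g, rfl⟩ := Submodule.mem_span_set'.1 ha
  choose p hp using fun i => (g i).2
  have key : ψ (star (∑ i, c i • (g i : (M.tensor N).Elt)) * ∑ i, c i • (g i : (M.tensor N).Elt)) =
      star c ⬝ᵥ (((Matrix.of fun i j => φ₁ (star (p i).1 * (p j).1)) ⊙
        (Matrix.of fun i j => φ₂ (star (p i).2 * (p j).2))) *ᵥ c) := by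
    rw [star_sum, Finset.sum_mul_sum, map_sum]
    refine Finset.sum_congr rfl fun i _ => ?_
    simp only [map_sum, mulVec, dotProduct, Finset.mul_sum]
    refine Finset.sum_congr rfl fun j _ => ?_
    simp only [← hp, Matrix.of_apply, hadamard_apply, star_smul, smul_mul_smul_comm, map_smul,
      smul_eq_mul, Pi.star_apply, star_tmul, tmul_mul_tmul, h.2]
    ring
  have hnn := ((h₁.posSemidef fun i => (p i).1).hadamard
    (h₂.posSemidef fun i => (p i).2)).dotProduct_mulVec_nonneg c
  rw [key]
  exact ⟨(Complex.nonneg_iff.1 hnn).1, (Complex.nonneg_iff.1 hnn).2.symm⟩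

open Filter Topology in
theorem IsTensorFunctional.isState {φ₁ : M.Elt →ₗ[ℂ] ℂ} {φ₂ : N.Elt →ₗ[ℂ] ℂ}
    {ψ : (M.tensor N).Elt →ₗ[ℂ] ℂ} (h : IsTensorFunctional φ₁ φ₂ ψ) (h₁ : IsState M φ₁)
    (h₂ : IsState N φ₂) : IsState (M.tensor N) ψ := by
  refine ⟨fun z => ?_, by rw [← tmul_one, h.2, h₁.2, h₂.2, one_mul]⟩
  obtain ⟨η, ξ, hψ⟩ := isNormalFunctional_iff.1 h.1
  have hinner : ∀ x : (M.tensor N).Elt,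
      ψ (star x * x) = ⟪ampliation x.1 η, ampliation x.1 ξ⟫_ℂ := by
    intro x
    rw [inner_ampliation_left, ← ampliation_mul, hψ]; rfl
  choose a ha haξ haη _ _ using fun n : ℕ =>
    exists_mem_algTensor_ampliation_lt z ξ η (Nat.one_div_pos_of_nat (α := ℝ) (n := n))
  have hlim : ∀ ζ : SqSummable (HilbertTensor H₁ H₂),
      (∀ n : ℕ, ‖ampliation (z - a n : (M.tensor N).Elt).1 ζ‖ < 1 / ((n : ℝ) + 1)) →
      Tendsto (fun n => ampliation (a n).1 ζ) atTop (𝓝 (ampliation z.1 ζ)) := by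
    intro ζ hζ
    refine tendsto_iff_norm_sub_tendsto_zero.2 (squeeze_zero (fun _ => norm_nonneg _)
      (fun n => ?_) tendsto_one_div_add_atTop_nhds_zero_nat)
    rw [← norm_neg, neg_sub, ← ampliation_sub]
    exact (hζ n).le
  have hconv : Tendsto (fun n => ψ (star (a n) * a n)) atTop (𝓝 (ψ (star z * z))) := by
    simp only [hinner]
    exact (hlim η haη).inner (hlim ξ haξ)
  have hclosed : IsClosed {w : ℂ | 0 ≤ w.re ∧ w.im = 0} :=
    (isClosed_le continuous_const Complex.continuous_re).inter
      (isClosed_eq Complex.continuous_im continuous_const)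
  exact hclosed.mem_of_tendsto hconv
    (Eventually.of_forall fun n => h.nonneg_of_mem_algTensor h₁ h₂ (ha n))

/-- The algebraic tensor product is dense in `M ⊗̄ N` for the seminorms of a normal functional. -/
theorem IsNormalFunctional.exists_mem_algTensor_lt {ψ : (M.tensor N).Elt →ₗ[ℂ] ℂ}
    (hψ : IsNormalFunctional (M.tensor N) ψ) (z : (M.tensor N).Elt) {ε : ℝ} (hε : 0 < ε) :
    ∃ a ∈ algTensor M N, ‖ψ (star (z - a) * (z - a))‖ < ε ∧ ‖ψ ((z - a) * star (z - a))‖ < ε := by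
  obtain ⟨η, ξ, rfl⟩ := isNormalFunctional_iff.1 hψ
  obtain ⟨a, ha, h1, h2, h3, h4⟩ :=
    exists_mem_algTensor_ampliation_lt z ξ η (Real.sqrt_pos.2 hε)
  have hinner : ∀ x : (M.tensor N).Elt, vectorFunctional (M.tensor N) η ξ (star x * x) =
      ⟪ampliation x.1 η, ampliation x.1 ξ⟫_ℂ := by
    intro x
    rw [inner_ampliation_left, ← ampliation_mul]; rfl
  have hlt : ∀ x : (M.tensor N).Elt, ‖ampliation x.1 η‖ < √ε → ‖ampliation x.1 ξ‖ < √ε →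
      ‖vectorFunctional (M.tensor N) η ξ (star x * x)‖ < ε := by
    intro x hη hξ
    rw [hinner]
    refine (norm_inner_le_norm _ _).trans_lt ?_
    calc _ < √ε * √ε := mul_lt_mul'' hη hξ (norm_nonneg _) (norm_nonneg _)
      _ = ε := Real.mul_self_sqrt hε.le
  refine ⟨a, ha, hlt _ h2 h1, ?_⟩
  have := hlt (star (z - a)) h4 h3
  rwa [star_star] at this

end Tensor

/-! ### Tensor products of normal `*`-homomorphisms -/

section TensorMap

variable {H₁ : Type u} [NormedAddCommGroup H₁] [InnerProductSpace ℂ H₁] [CompleteSpace H₁]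
  {H₂ : Type v} [NormedAddCommGroup H₂] [InnerProductSpace ℂ H₂] [CompleteSpace H₂]
  {K₁ : Type u'} [NormedAddCommGroup K₁] [InnerProductSpace ℂ K₁] [CompleteSpace K₁]
  {K₂ : Type v'} [NormedAddCommGroup K₂] [InnerProductSpace ℂ K₂] [CompleteSpace K₂]
  {M : VonNeumannAlgebra H₁} {N : VonNeumannAlgebra H₂}
  {M' : VonNeumannAlgebra K₁} {N' : VonNeumannAlgebra K₂}
  {f : M.Elt →ₗ[ℂ] M'.Elt} {g : N.Elt →ₗ[ℂ] N'.Elt}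
  {Φ : (M.tensor N).Elt →ₗ[ℂ] (M'.tensor N').Elt}

theorem IsTensorMap.map_mul (h : IsTensorMap f g Φ) (hf : ∀ x y, f (x * y) = f x * f y)
    (hg : ∀ x y, g (x * y) = g x * g y) (z w : (M.tensor N).Elt) : Φ (z * w) = Φ z * Φ w := by
  refine ext_normalFunctional fun φ hφ => ?_
  have hleft : ∀ z x y, φ (Φ (z * tmul x y)) = φ (Φ z * Φ (tmul x y)) := by
    intro z x y
    refine LinearMap.congr_fun (IsNormalFunctional.ext_tmul ((h.1 φ hφ).mulRight (tmul x y))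
      (h.1 _ (hφ.mulRight (Φ (tmul x y)))) fun x' y' => ?_) z
    simp only [LinearMap.comp_apply, LinearMap.mulRight_apply, tmul_mul_tmul, h.2, hf, hg]
  exact LinearMap.congr_fun (IsNormalFunctional.ext_tmul ((h.1 φ hφ).mulLeft z)
    (h.1 _ (hφ.mulLeft (Φ z))) fun x y => hleft z x y) w

theorem IsTensorMap.map_star (h : IsTensorMap f g Φ) (hf : ∀ x, f (star x) = star (f x))
    (hg : ∀ x, g (star x) = star (g x)) (z : (M.tensor N).Elt) : Φ (star z) = star (Φ z) := by
  refine ext_normalFunctional fun φ hφ => star_injective ?_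
  refine LinearMap.congr_fun (IsNormalFunctional.ext_tmul (h.1 φ hφ).starFunctional
    (h.1 _ hφ.starFunctional) fun x y => ?_) z
  change star (φ (Φ (star (tmul x y)))) = star (φ (star (Φ (tmul x y))))
  rw [star_tmul, h.2, h.2, star_tmul, hf, hg]

end TensorMap

/-! ### The KMS condition for tensor products of states -/

section KMS

variable {H₁ : Type u} [NormedAddCommGroup H₁] [InnerProductSpace ℂ H₁] [CompleteSpace H₁]
  {H₂ : Type v} [NormedAddCommGroup H₂] [InnerProductSpace ℂ H₂] [CompleteSpace H₂]
  {M : VonNeumannAlgebra H₁} {N : VonNeumannAlgebra H₂} {β : ℝ}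

theorem IsKMS.hasStripExtension {τ : ℝ → M.Elt ≃⋆ₐ[ℂ] M.Elt} {φ : M.Elt →ₗ[ℂ] ℂ}
    (h : IsKMS τ β φ) (x y : M.Elt) :
    HasStripExtension β (fun t => φ (x * τ t y)) (fun t => φ (τ t y * x)) :=
  h x y

/-- A KMS functional is invariant: the function of the KMS condition for the pair `1, y` has equal
boundary values. -/
theorem IsKMS.apply_eq_apply {τ : ℝ → M.Elt ≃⋆ₐ[ℂ] M.Elt} {φ : M.Elt →ₗ[ℂ] ℂ}
    (h : IsKMS τ β φ) (hβ : β ≠ 0) (s t : ℝ) (y : M.Elt) : φ (τ s y) = φ (τ t y) := by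
  have h1 := h.hasStripExtension 1 y
  simp only [one_mul, mul_one] at h1
  exact h1.apply_eq_apply_of_same_boundary hβ s t

variable {χ₁ : M.Elt →ₗ[ℂ] ℂ} {χ₂ : N.Elt →ₗ[ℂ] ℂ} {ψ : (M.tensor N).Elt →ₗ[ℂ] ℂ}
  {τ₁ : ℝ → M.Elt ≃⋆ₐ[ℂ] M.Elt} {τ₂ : ℝ → N.Elt ≃⋆ₐ[ℂ] N.Elt}
  {Φ : ℝ → (M.tensor N).Elt →ₗ[ℂ] (M.tensor N).Elt}

theorem IsTensorFunctional.apply_tensorMap (hψ : IsTensorFunctional χ₁ χ₂ ψ)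
    {f : M.Elt →ₗ[ℂ] M.Elt} {g : N.Elt →ₗ[ℂ] N.Elt} {F : (M.tensor N).Elt →ₗ[ℂ] (M.tensor N).Elt}
    (hF : IsTensorMap f g F) (hf : ∀ x, χ₁ (f x) = χ₁ x) (hg : ∀ y, χ₂ (g y) = χ₂ y)
    (z : (M.tensor N).Elt) : ψ (F z) = ψ z := by
  refine LinearMap.congr_fun (IsNormalFunctional.ext_tmul (hF.1 ψ hψ.1) hψ.1 fun x y => ?_) z
  rw [LinearMap.comp_apply, hF.2, hψ.2, hψ.2, hf, hg]

/-- The KMS condition on the algebraic tensor product: the KMS functions of elementary tensors are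
products of KMS functions. -/
theorem IsTensorFunctional.hasStripExtension_of_mem_algTensor (hψ : IsTensorFunctional χ₁ χ₂ ψ)
    (h₁ : IsKMS τ₁ β χ₁) (h₂ : IsKMS τ₂ β χ₂)
    (hΦ : ∀ t, IsTensorMap (τ₁ t).toAlgEquiv.toLinearMap (τ₂ t).toAlgEquiv.toLinearMap (Φ t))
    {a b : (M.tensor N).Elt} (ha : a ∈ algTensor M N) (hb : b ∈ algTensor M N) :
    HasStripExtension β (fun t => ψ (a * Φ t b)) (fun t => ψ (Φ t b * a)) := by
  induction ha using Submodule.span_induction with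
  | zero => simpa using! HasStripExtension.zero
  | add a a' _ _ iha iha' =>
    simp only [add_mul, mul_add, map_add]
    exact iha.add iha'
  | smul c a _ iha =>
    simp only [smul_mul_assoc, mul_smul_comm, map_smul]
    exact iha.const_smul c
  | mem a ha =>
    obtain ⟨⟨x, y⟩, rfl⟩ := ha
    induction hb using Submodule.span_induction with
    | zero => simpa using! HasStripExtension.zero
    | add b b' _ _ ihb ihb' =>
      simp only [add_mul, mul_add, map_add]
      exact ihb.add ihb'
    | smul c b _ ihb =>
      simp only [smul_mul_assoc, mul_smul_comm, map_smul]
      exact ihb.const_smul c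
    | mem b hb =>
      obtain ⟨⟨x', y'⟩, rfl⟩ := hb
      have h := (h₁.hasStripExtension x x').mul (h₂.hasStripExtension y y')
      simp only [(hΦ _).2, tmul_mul_tmul, hψ.2]
      exact h

/-- The approximation by algebraic tensors, in the form in which the Cauchy-Schwarz inequality is
applied to the boundary values of the KMS functions. -/
theorem IsNormalFunctional.exists_mem_algTensor_mul_le (hψ : IsNormalFunctional (M.tensor N) ψ)
    (z w : (M.tensor N).Elt) {ε : ℝ} (hε : 0 < ε) :
    ∃ a ∈ algTensor M N,
      ‖ψ (z * star z)‖ * ‖ψ (star (w - a) * (w - a))‖ ≤ ε ^ 2 ∧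
      ‖ψ ((w - a) * star (w - a))‖ * ‖ψ (star z * z)‖ ≤ ε ^ 2 := by
  have h1 := norm_nonneg (ψ (z * star z))
  have h2 := norm_nonneg (ψ (star z * z))
  have hC : 0 < ‖ψ (z * star z)‖ + ‖ψ (star z * z)‖ + 1 := by linarith
  obtain ⟨a, ha, ha1, ha2⟩ := hψ.exists_mem_algTensor_lt w (div_pos (pow_pos hε 2) hC)
  rw [lt_div_iff₀ hC] at ha1 ha2
  refine ⟨a, ha, le_trans ?_ ha1.le, le_trans ?_ ha2.le⟩
  · rw [mul_comm]
    exact mul_le_mul_of_nonneg_left (by linarith) (norm_nonneg _)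
  · exact mul_le_mul_of_nonneg_left (by linarith) (norm_nonneg _)

/-- The tensor product `ψ` of two normal KMS states satisfies the KMS condition for the tensor
product `Φ` of the automorphism groups. As `ψ` is invariant under `Φ`, the Cauchy-Schwarz inequality
bounds the boundary values uniformly in `t`, so the condition passes from the algebraic tensor
product to `M ⊗̄ N`. -/
theorem IsTensorFunctional.hasStripExtension (hψ : IsTensorFunctional χ₁ χ₂ ψ) (hβ : β ≠ 0)
    (hs₁ : IsState M χ₁) (hs₂ : IsState N χ₂) (h₁ : IsKMS τ₁ β χ₁) (h₂ : IsKMS τ₂ β χ₂)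
    (hinv₁ : ∀ t x, χ₁ (τ₁ t x) = χ₁ x) (hinv₂ : ∀ t y, χ₂ (τ₂ t y) = χ₂ y)
    (hΦ : ∀ t, IsTensorMap (τ₁ t).toAlgEquiv.toLinearMap (τ₂ t).toAlgEquiv.toLinearMap (Φ t))
    (z w : (M.tensor N).Elt) :
    HasStripExtension β (fun t => ψ (z * Φ t w)) (fun t => ψ (Φ t w * z)) := by
  have hst := hψ.isState hs₁ hs₂
  have hmul : ∀ t z w, Φ t (z * w) = Φ t z * Φ t w := fun t =>
    (hΦ t).map_mul (fun x y => map_mul (τ₁ t) x y) (fun x y => map_mul (τ₂ t) x y)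
  have hstar : ∀ t z, Φ t (star z) = star (Φ t z) := fun t =>
    (hΦ t).map_star (fun x => map_star (τ₁ t) x) (fun x => map_star (τ₂ t) x)
  have hinv : ∀ t z, ψ (Φ t z) = ψ z := fun t =>
    hψ.apply_tensorMap (hΦ t) (hinv₁ t) (hinv₂ t)
  have hle₁ : ∀ t z w, ‖ψ (z * Φ t w)‖ ^ 2 ≤
      ‖ψ (z * star z)‖ * ‖ψ (star w * w)‖ := by
    intro t z w
    have h := hst.norm_map_star_mul_sq_le (star z) (Φ t w)
    rw [star_star, ← hstar, ← hmul, hinv] at h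
    refine h.trans (mul_le_mul (Complex.re_le_norm _) (Complex.re_le_norm _) (hst.1 w).1
      (norm_nonneg _))
  have hle₂ : ∀ t z w, ‖ψ (Φ t w * z)‖ ^ 2 ≤
      ‖ψ (w * star w)‖ * ‖ψ (star z * z)‖ := by
    intro t z w
    have h := hst.norm_map_star_mul_sq_le (star (Φ t w)) z
    rw [star_star, ← hstar, ← hmul, hinv] at h
    refine h.trans (mul_le_mul (Complex.re_le_norm _) (Complex.re_le_norm _) (hst.1 z).1
      (norm_nonneg _))
  have hstep : ∀ z ∈ algTensor M N, ∀ w,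
      HasStripExtension β (fun t => ψ (z * Φ t w)) (fun t => ψ (Φ t w * z)) := by
    intro z hz w
    refine HasStripExtension.of_approx hβ fun ε hε => ?_
    obtain ⟨a, ha, ha1, ha2⟩ := hψ.1.exists_mem_algTensor_mul_le z w hε
    refine ⟨_, _, hψ.hasStripExtension_of_mem_algTensor h₁ h₂ hΦ hz ha, fun t => ?_, fun t => ?_⟩
    · rw [norm_sub_rev, ← map_sub, ← mul_sub, ← map_sub]
      exact le_of_sq_le_sq ((hle₁ t z (w - a)).trans ha1) hε.le
    · rw [norm_sub_rev, ← map_sub, ← sub_mul, ← map_sub]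
      exact le_of_sq_le_sq ((hle₂ t z (w - a)).trans ha2) hε.le
  refine HasStripExtension.of_approx hβ fun ε hε => ?_
  obtain ⟨a, ha, ha1, ha2⟩ := hψ.1.exists_mem_algTensor_mul_le w z hε
  refine ⟨_, _, hstep a ha w, fun t => ?_, fun t => ?_⟩
  · rw [norm_sub_rev, ← map_sub, ← sub_mul]
    exact le_of_sq_le_sq ((hle₁ t (z - a) w).trans ha2) hε.le
  · rw [norm_sub_rev, ← map_sub, ← mul_sub]
    exact le_of_sq_le_sq ((hle₂ t (z - a) w).trans ha1) hε.le

end KMS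

end VonNeumannAlgebra

/-! ### Quantized characters -/

namespace QuantumGroupWStarAlgebra

open VonNeumannAlgebra

variable {H : Type u} [NormedAddCommGroup H] [InnerProductSpace ℂ H] [CompleteSpace H]
  {M : VonNeumannAlgebra H}

/-- The compatibility `δ ∘ τ_t = (τ_t ⊗ τ_t) ∘ δ` contains the existence of `τ_t ⊗ τ_t`: the
left side sends `1` to `1 ≠ 0`, which excludes the default value `0` of `tensorMap`. -/
theorem isTensorMap_τ [Nontrivial (M.tensor M).Elt] (G : QuantumGroupWStarAlgebra M) (t : ℝ) :
    IsTensorMap (G.τ t).toAlgEquiv.toLinearMap (G.τ t).toAlgEquiv.toLinearMap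
      (tensorMap (G.τ t).toAlgEquiv.toLinearMap (G.τ t).toAlgEquiv.toLinearMap) := by
  have h : ∃ Φ, IsTensorMap (G.τ t).toAlgEquiv.toLinearMap (G.τ t).toAlgEquiv.toLinearMap Φ := by
    by_contra hne
    have h1 := G.δ_τ t 1
    rw [tensorMap, dif_neg hne, map_one, map_one, LinearMap.zero_apply] at h1
    exact one_ne_zero h1
  rw [tensorMap, dif_pos h]
  exact h.choose_spec

theorem apply_τ_of_mem_Char (G : QuantumGroupWStarAlgebra M) {χ : M.Elt →ₗ[ℂ] ℂ}
    (hχ : χ ∈ G.Char) (t : ℝ) (x : M.Elt) : χ (G.τ t x) = χ x := by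
  rw [hχ.2.2.apply_eq_apply (by norm_num) t 0, G.τ_zero]

end QuantumGroupWStarAlgebra

end

open VonNeumannAlgebra in
theorem mainTheorem8 {H : Type*} [NormedAddCommGroup H] [InnerProductSpace ℂ H] [CompleteSpace H]
    {M : VonNeumannAlgebra H} (G : QuantumGroupWStarAlgebra M) (χ₁ χ₂ : M.Elt →ₗ[ℂ] ℂ)
    (h₁ : χ₁ ∈ G.Char) (h₂ : χ₂ ∈ G.Char) :
    G.tensorChar χ₁ χ₂ ∈ G.Char := by
  have hψ := isTensorFunctional_tensorFunctional h₁.1 h₂.1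
  have hst := hψ.isState h₁.2.1 h₂.2.1
  -- an algebra with a state is not zero
  have : Nontrivial (M.tensor M).Elt := by
    refine ⟨1, 0, fun h => ?_⟩
    have h' := hst.2
    rw [h, map_zero] at h'
    exact zero_ne_one h'
  refine ⟨G.normal_δ _ hψ.1, ⟨fun x => ?_, ?_⟩, fun x y => ?_⟩
  · have h := hst.1 (G.δ x)
    rw [← map_star, ← map_mul] at h
    exact h
  · change tensorFunctional χ₁ χ₂ (G.δ 1) = 1
    rw [map_one, hst.2]
  · have h := hψ.hasStripExtension (by norm_num) h₁.2.1 h₂.2.1 h₁.2.2 h₂.2.2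
      (G.apply_τ_of_mem_Char h₁) (G.apply_τ_of_mem_Char h₂) G.isTensorMap_τ (G.δ x) (G.δ y)
    simp only [← G.δ_τ, ← map_mul] at h
    exact h
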